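/- **Model.** A server serves users $n=1,\dots,N$ in slots $t=0,1,\dots$. The number $A_n(t)\in\{0,\dots,A_{\max}\}$ of packets arriving for user $n$ at time $t$ is i.i.d. in $t$ and independent across users, with mean $a_n$. The channel state $S_n(t)$ of user $n$ is an ergodic (irreducible, aperiodic) Markov chain on $\{1,\dots,K\}$ with transition matrix $P_n$. Resource levels are chosen from a bounded set $\mathcal E\subset[0,\infty)$ with $0\in\mathcal E\neq\{0\}$. A transmission of a packet of user $n$ at level $e$ in channel state $i$ costs $e$ and succeeds with probability $\zeta_n(i,e)\in[0,1]$, where $\zeta_n(i,0)=0$ and $\zeta_n(i,\cdot)$ is concave (decreasing chord slopes) and strictly increasing on $\mathcal E$; for each $n$ the states are totally ordered: for all $i,j$, either $\zeta_n(i,\cdot)\le\zeta_n(j,\cdot)$ on $\mathcal E$ or the reverse. Let $i_n^{\min}$ and $i_n^{\max}$ be a smallest and a largest state in this order. Arrivals, channels and transmission outcomes are independent of each other (given the states and the chosen levels). User $n$ has deadline $\tau_n\ge 0$ and weight $\beta_n\ge0$. *Zero prediction:* a packet of user $n$ arriving at time $t$ can be transmitted, until it is delivered, in the $\tau_n$ slots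 $t,\dots,t+\tau_n-1$, and is then discarded. *Perfect prediction* with windows $D_n\ge 0$: the packets of $A_n(t)$ are already known, and can be served, from time $t-D_n$ on, so each can be transmitted in $\tau_n+D_n$ slots. A policy is a causal, possibly randomized rule that in every slot, on observing the current and past system states (channel states and packets present with their times to deadline), assigns a level to every present packet. With $X_n(t)$ the number of packets of user $n$ delivered at time $t$ and $E_n(t)$ the resource spent on user $n$ at time $t$, put $$x_n=\lim_{T\to\infty}\frac1T\,\mathbb E\sum_{t=1}^T X_n(t),\qquad E_{av}=\lim_{T\to\infty}\frac1T\,\mathbb E\sum_{t=1}^T\sum_{n=1}^N E_n(t).$$ For a budget $B\ge0$, let $\phi^*$ be the supremum of $\sum_n\beta_nx_n$ over all policies for which these limits exist and $E_{av}\le B$; write $\phi^*_0$ for zero prediction and $\phi^*_P$ for perfect prediction. The initial state of each system may have any distribution. If $B=0$, assume moreover that each $\zeta_n(i,\cdot)$ is continuous at $0$ relative to $\mathcal E$ (automatic if $\mathcal E$ is finite). **Bounds.** For $\lambda\ge 0$ define (maxima are read as suprema if they are not attained) $V_n^l(0)=V_n^u(0)=0$ and, for $\tau\ge1$, $$V_n^l(\tau)=\max_{e\in\mathcal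 E,\,e>0}\frac{1-[1-\zeta_n(i_n^{\min},e)]^\tau}{\zeta_n(i_n^{\min},e)}\,\bigl[-\lambda e+\zeta_n(i_n^{\min},e)\beta_n\bigr],$$ $$V_n^u(\tau)=\sum_{z=1}^{\tau}\max_{e\in\mathcal E}\bigl\{-\lambda e+\zeta_n(i_n^{\max},e)\bigl(\beta_n-\max\{0,V_n^l(z-1)\}\bigr)\bigr\},$$ $$g^l_P(\lambda)=\lambda B+\sum_{n=1}^N a_n\max\{0,V_n^l(\tau_n+D_n)\},\qquad g^u_P(\lambda)=\lambda B+\sum_{n=1}^N a_n\min\{\beta_n,V_n^u(\tau_n+D_n)\},$$ and let $g^l_0,g^u_0$ be the same functions with $D_n=0$ for all $n$. **Theorem.** If $\lambda_0^*$ minimizes $g_0^l$ over $\lambda\ge0$ and $\lambda_P^*$ minimizes $g_P^l$ over $\lambda\ge 0$, then $$g^l_P(\lambda^*_P)-g^u_0(\lambda^*_P)\;\le\;\phi^*_P-\phi^*_0\;\le\; g^u_P(\lambda^*_0)-g^l_0(\lambda^*_0).$$ -/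

import Mathlib

open Filter Topology MeasureTheory

namespace TimelyThroughput

noncomputable section

/-- The data of a delay-constrained system with `N` users, `K` channel states per user and at most
`A` packet arrivals per user and slot. -/
structure Model (N K A : ℕ) where
  /-- the set of resource consumption levels -/
  levels : Set ℝ
  zero_mem_levels : (0 : ℝ) ∈ levels
  levels_nonneg : ∀ e ∈ levels, 0 ≤ e
  levels_bddAbove : BddAbove levels
  exists_pos_level : ∃ e ∈ levels, 0 < e
  /-- `ζ n i e`: success probability of a transmission for user `n` in channel state `i` at
  level `e` -/
  ζ : Fin N → Fin K → ℝ → ℝ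
  ζ_zero : ∀ n i, ζ n i 0 = 0
  ζ_le_one : ∀ n i, ∀ e ∈ levels, ζ n i e ≤ 1
  ζ_strictMonoOn : ∀ n i, StrictMonoOn (ζ n i) levels
  /-- concavity on `levels`, which may be a discrete set: the slopes of chords decrease -/
  ζ_concave : ∀ n i, ∀ x ∈ levels, ∀ y ∈ levels, ∀ z ∈ levels, x < y → y < z →
    (ζ n i z - ζ n i y) / (z - y) ≤ (ζ n i y - ζ n i x) / (y - x)
  /-- the channel states are totally ordered by their success probabilities -/
  ζ_total : ∀ n i j, (∀ e ∈ levels, ζ n i e ≤ ζ n j e) ∨ (∀ e ∈ levels, ζ n j e ≤ ζ n i e)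
  /-- transition matrices of the channels -/
  P : Fin N → Matrix (Fin K) (Fin K) ℝ
  P_stochastic : ∀ n, P n ∈ Matrix.rowStochastic ℝ (Fin K)
  /-- ergodicity: some power of the transition matrix is entrywise positive -/
  P_ergodic : ∀ n, (P n).IsPrimitive
  /-- `arr n m`: probability that exactly `m` packets arrive for user `n` in a slot -/
  arr : Fin N → Fin (A + 1) → ℝ
  arr_mem : ∀ n, arr n ∈ stdSimplex ℝ (Fin (A + 1))
  /-- deadlines -/
  τ : Fin N → ℕ
  /-- weights -/
  β : Fin N → ℝ
  β_nonneg : ∀ n, 0 ≤ β n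

variable {N K A : ℕ}

/-- The arrival rate `a n = 𝔼[A_n(t)]`. -/
def Model.rate (M : Model N K A) (n : Fin N) : ℝ := ∑ m : Fin (A + 1), (m : ℝ) * M.arr n m

/-! ### The controlled Markov chain

`L n` is the number of slots during which a packet of user `n` can be transmitted: `τ n` without
prediction, and `τ n + D n` with perfect prediction over a window of `D n` slots, where a packet
becomes visible `D n` slots before it arrives. -/

/-- The place `⟨n, ℓ, k⟩` is that of the `k`-th packet of user `n` among those whose
time-to-deadline is `ℓ + 1`. -/
abbrev Place (A : ℕ) (L : Fin N → ℕ) : Type := Σ n : Fin N, Fin (L n) × Fin A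

/-- A system state: the channel states of all users, and for each place whether it holds a packet
that is still at the source. -/
abbrev State (K A : ℕ) (L : Fin N → ℕ) : Type := (Fin N → Fin K) × (Place A L → Bool)

/-- An action assigns a resource level to each place (irrelevant for places without a packet). -/
abbrev Action (M : Model N K A) (L : Fin N → ℕ) : Type := Place A L → M.levels

/-- The randomness of one slot: success or failure of the transmission at each place, the numbers
of packets that become visible in the next slot, and the next channel states. -/
abbrev Noise (K A : ℕ) (L : Fin N → ℕ) : Type :=
  (Place A L → Bool) × (Fin N → Fin (A + 1)) × (Fin N → Fin K)

/-- The probability of an outcome `w` of one slot, in state `s` and under action `a`: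
transmissions, arrivals and channels are independent of each other. -/
def noiseProb (M : Model N K A) (L : Fin N → ℕ) (s : State K A L) (a : Action M L)
    (w : Noise K A L) : ℝ :=
  (∏ p : Place A L,
      if w.1 p then M.ζ p.1 (s.1 p.1) (a p : ℝ) else 1 - M.ζ p.1 (s.1 p.1) (a p : ℝ)) *
    (∏ n, M.arr n (w.2.1 n)) * ∏ n, M.P n (s.1 n) (w.2.2 n)

/-- The next state. Undelivered packets come one slot closer to their deadline, those whose
time-to-deadline becomes `0` are discarded, and the new packets enter at time-to-deadline `L n`. -/
def next (L : Fin N → ℕ) (s : State K A L) (w : Noise K A L) : State K A L :=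
  (w.2.2, fun p =>
    if h : (p.2.1 : ℕ) + 1 < L p.1 then
      s.2 ⟨p.1, ⟨p.2.1 + 1, h⟩, p.2.2⟩ && !w.1 ⟨p.1, ⟨p.2.1 + 1, h⟩, p.2.2⟩
    else decide ((p.2.2 : ℕ) < (w.2.1 p.1 : ℕ)))

/-- A randomized scheduling policy: it chooses a probability distribution over actions from the
current state and the list of past states (most recent first). -/
abbrev Policy (M : Model N K A) (L : Fin N → ℕ) : Type :=
  State K A L → List (State K A L) → ProbabilityMeasure (Action M L)

/-- Expectation of `f` (action, outcome) over one slot, given the current state `s` and the list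
`h` of past states. -/
def slotExp (M : Model N K A) (L : Fin N → ℕ) (π : Policy M L) (s : State K A L)
    (h : List (State K A L)) (f : Action M L → Noise K A L → ℝ) : ℝ :=
  ∫ a, ∑ w : Noise K A L, noiseProb M L s a w * f a w ∂(π s h : Measure (Action M L))

/-- Expectation of `f` (state at time `t`, past states) when the policy `π` is used and the state
at time `0` has distribution `μ`. -/
def histExp (M : Model N K A) (L : Fin N → ℕ) (π : Policy M L) (μ : State K A L → ℝ) :
    ℕ → (State K A L → List (State K A L) → ℝ) → ℝ
  | 0, f => ∑ s, μ s * f s []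
  | t + 1, f => histExp M L π μ t fun s h =>
      slotExp M L π s h fun _ w => f (next L s w) (s :: h)

/-- The number of packets of user `n` that are delivered in a slot. -/
def delivered (L : Fin N → ℕ) (n : Fin N) (s : State K A L) (w : Noise K A L) : ℝ :=
  ∑ p : Place A L, if p.1 = n ∧ s.2 p = true ∧ w.1 p = true then 1 else 0

/-- The resource consumed by the transmissions of packets of user `n` in a slot. -/
def resource (M : Model N K A) (L : Fin N → ℕ) (n : Fin N) (s : State K A L)
    (a : Action M L) : ℝ :=
  ∑ p : Place A L, if p.1 = n ∧ s.2 p = true then (a p : ℝ) else 0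

/-- `𝔼[X_n(t)]` -/
def expDelivered (M : Model N K A) (L : Fin N → ℕ) (π : Policy M L) (μ : State K A L → ℝ)
    (n : Fin N) (t : ℕ) : ℝ :=
  histExp M L π μ t fun s h => slotExp M L π s h fun _ w => delivered L n s w

/-- `𝔼[E_n(t)]` -/
def expResource (M : Model N K A) (L : Fin N → ℕ) (π : Policy M L) (μ : State K A L → ℝ)
    (n : Fin N) (t : ℕ) : ℝ :=
  histExp M L π μ t fun s h => slotExp M L π s h fun a _ => resource M L n s a

/-- `x` is the vector of timely-throughputs of the policy `π`. -/
def HasThroughput (M : Model N K A) (L : Fin N → ℕ) (π : Policy M L) (μ : State K A L → ℝ)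
    (x : Fin N → ℝ) : Prop :=
  ∀ n, Tendsto (fun T : ℕ => (1 / (T : ℝ)) * ∑ t ∈ Finset.Icc 1 T, expDelivered M L π μ n t)
    atTop (𝓝 (x n))

/-- `e` is the average resource expenditure of the policy `π`. -/
def HasExpenditure (M : Model N K A) (L : Fin N → ℕ) (π : Policy M L) (μ : State K A L → ℝ)
    (e : ℝ) : Prop :=
  Tendsto (fun T : ℕ => (1 / (T : ℝ)) *
    ∑ t ∈ Finset.Icc 1 T, ∑ n, expResource M L π μ n t) atTop (𝓝 e)

/-- The optimal weighted timely-throughput under the average resource constraint `B`. -/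
def optThroughput (M : Model N K A) (L : Fin N → ℕ) (μ : State K A L → ℝ) (B : ℝ) : ℝ :=
  sSup {v : ℝ | ∃ (π : Policy M L) (x : Fin N → ℝ) (e : ℝ), HasThroughput M L π μ x ∧
    HasExpenditure M L π μ e ∧ e ≤ B ∧ v = ∑ n, M.β n * x n}

/-! ### The bounds -/

/-- `V_n^l(t)` for the multiplier `lam`; `iMin n` is the worst channel state of user `n`. -/
def lowerValue (M : Model N K A) (iMin : Fin N → Fin K) (lam : ℝ) (n : Fin N) (t : ℕ) : ℝ :=
  ⨆ e : {e : ℝ // e ∈ M.levels ∧ 0 < e},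
    (1 - (1 - M.ζ n (iMin n) e) ^ t) / M.ζ n (iMin n) e *
      (-lam * e + M.ζ n (iMin n) e * M.β n)

theorem lowerValue_zero (M : Model N K A) (iMin : Fin N → Fin K) (lam : ℝ) (n : Fin N) :
    lowerValue M iMin lam n 0 = 0 := by
  simp [lowerValue]

/-- `V_n^u(t)` for the multiplier `lam`; `iMax n` is the best channel state of user `n`. -/
def upperValue (M : Model N K A) (iMin iMax : Fin N → Fin K) (lam : ℝ) (n : Fin N) (t : ℕ) : ℝ :=
  ∑ z ∈ Finset.Icc 1 t, ⨆ e : M.levels,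
    (-lam * e + M.ζ n (iMax n) e * (M.β n - max 0 (lowerValue M iMin lam n (z - 1))))

/-- The lower bound `g^l` of the dual function, for packet lifetimes `L`. -/
def dualLower (M : Model N K A) (L : Fin N → ℕ) (iMin : Fin N → Fin K) (B lam : ℝ) : ℝ :=
  lam * B + ∑ n, M.rate n * max 0 (lowerValue M iMin lam n (L n))

/-- The upper bound `g^u` of the dual function, for packet lifetimes `L`. -/
def dualUpper (M : Model N K A) (L : Fin N → ℕ) (iMin iMax : Fin N → Fin K) (B lam : ℝ) : ℝ :=
  lam * B + ∑ n, M.rate n * min (M.β n) (upperValue M iMin iMax lam n (L n))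

end

end TimelyThroughput

/-! Price the resource at `lam ≥ 0` per unit. The Lagrangian problem then splits over packets: each
packet is a finite-horizon problem of balancing transmission costs against the reward `β n`. The
dual function at `lam` is `lam * B` plus the arrival rates times the packet values, and `dualLower`,
`dualUpper` replace these values by bounds that do not depend on the channel. It suffices to show,
for each lifetime vector `L`, that the optimum is at most `dualUpper` at every `lam ≥ 0` and at
least `dualLower` at its minimizer. The theorem follows by subtraction, using one multiplier for
both systems.

Upper bound (weak duality). Give a packet with time-to-deadline `t` the value `min (β n) (upperValue
n t)`. By `upperValue_bellman` no level in any channel state has a net expected gain over this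
value. Summed over packets, this is a drift inequality for a bounded potential; in Cesàro means the
potential telescopes away and only the value of the arrivals remains (`reward_le_of_drift`). This
covers history-dependent randomized policies.

Lower bound (strong duality). In a good channel state a level can be mixed with level `0` until its
success probability equals the one in the worst state, at no greater cost (`level_mem_slotRegion`).
Hence there are one-slot pairs (cost, success) available in every state. Chaining them over a
packet's lifetime gives plans, and a stationary policy realizes them (`exists_policy_of_plan`).
Plans form a convex set, so the pairs (cost, reward) strictly dominated by a plan form an open
convex set in the plane. If `B > 0` and `(B, c)` lies outside it, a separating line yields a
multiplier at which `dualLower` is at most `c` (`exists_dualLower_le_of_notMem`). With `c` just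
below the minimum this is impossible, so some plan within budget earns more than `c`. If `B = 0`,
continuity at `0` makes the infimum of `dualLower` nonpositive, and idling suffices. -/

namespace TimelyThroughput

/-! ### Generalities -/

/-- The Cesàro means of the iterates of a finite-dimensional contraction in the sup norm
converge. -/
theorem exists_tendsto_cesaro_pow {α : Type*} [Fintype α] (Q : (α → ℝ) →ₗ[ℝ] (α → ℝ))
    (hQ : ∀ (f : α → ℝ) (C : ℝ), (∀ s, |f s| ≤ C) → ∀ s, |Q f s| ≤ C) (f : α → ℝ) (s : α) :
    ∃ l, Tendsto (fun T : ℕ => (1 / (T : ℝ)) * ∑ t ∈ Finset.Icc 1 T, (Q ^ t) f s)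
      atTop (𝓝 l) := by
  have hpow : ∀ (t : ℕ) (g : α → ℝ) (C : ℝ), (∀ s, |g s| ≤ C) → ∀ s, |(Q ^ t) g s| ≤ C := by
    intro t
    induction t with
    | zero => intro g C h s; simpa using h s
    | succ t ih => intro g C h; rw [pow_succ]; exact ih _ _ (hQ g C h)
  have hbd : ∀ g : α → ℝ, ∃ C, ∀ s, |g s| ≤ C := fun g =>
    ⟨∑ s, |g s|, fun s => Finset.single_le_sum (f := fun s => |g s|)
      (fun _ _ => abs_nonneg _) (Finset.mem_univ s)⟩
  -- If `x = (Q - 1) y` is fixed by `Q`, then `Q ^ t y = y + t • x`, which stays bounded only for `x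
  -- = 0`. By rank-nullity kernel and range of `Q - 1` then span the space. On the kernel the
  -- averages are constant, on the range they telescope to `O(1 / T)`.
  have hdisj : Disjoint (LinearMap.ker (Q - 1)) (LinearMap.range (Q - 1)) := by
    rw [Submodule.disjoint_def]
    rintro x hx ⟨y, rfl⟩
    set x := (Q - 1) y with hxdef
    have hQx : Q x = x := by
      have : Q x - x = 0 := by simpa using hx
      exact sub_eq_zero.1 this
    have hQy : Q y = y + x := by simp [hxdef]
    have hit : ∀ t : ℕ, (Q ^ t) y = y + (t : ℝ) • x := by
      intro t
      induction t with
      | zero => simp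
      | succ t ih =>
        rw [pow_succ', Module.End.mul_apply, ih, map_add, map_smul, hQx, hQy]
        push_cast; module
    obtain ⟨C, hC⟩ := hbd y
    funext s
    by_contra hne
    have hpos : 0 < |x s| := abs_pos.2 hne
    obtain ⟨t, ht⟩ := exists_nat_gt ((2 * C) / |x s|)
    rw [div_lt_iff₀ hpos] at ht
    have h1 := hpow t y C hC s
    rw [hit] at h1
    have h2 := hC s
    have h3 : |(t : ℝ) * x s| = t * |x s| := by rw [abs_mul, Nat.abs_cast]
    have h4 : |(t : ℝ) * x s| ≤ |y s + t * x s| + |y s| := by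
      have := abs_sub (y s + t * x s) (y s)
      simpa using this
    simp only [Pi.add_apply, Pi.smul_apply, smul_eq_mul] at h1
    linarith
  have htop : LinearMap.ker (Q - 1) ⊔ LinearMap.range (Q - 1) = ⊤ := by
    apply Submodule.eq_top_of_disjoint _ _ _ hdisj
    rw [add_comm, LinearMap.finrank_range_add_finrank_ker]
  obtain ⟨z, hz, y, ⟨w, rfl⟩, rfl⟩ := Submodule.mem_sup.1 (htop ▸ Submodule.mem_top (x := f))
  have hQz : ∀ t : ℕ, (Q ^ t) z = z := by
    have h1 : Q z = z := by
      have : Q z - z = 0 := by simpa using hz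
      exact sub_eq_zero.1 this
    intro t
    induction t with
    | zero => simp
    | succ t ih => rw [pow_succ, Module.End.mul_apply, h1, ih]
  obtain ⟨C, hC⟩ := hbd w
  have hsum : ∀ T : ℕ, ∑ t ∈ Finset.Icc 1 T, (Q ^ t) (z + (Q - 1) w) s
      = T * z s + ((Q ^ (T + 1)) w s - Q w s) := by
    intro T
    induction T with
    | zero => simp
    | succ T ih =>
      rw [Finset.sum_Icc_succ_top (by omega), ih, map_add, hQz]
      have : (Q ^ (T + 1)) ((Q - 1) w) = (Q ^ (T + 1 + 1)) w - (Q ^ (T + 1)) w := by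
        rw [LinearMap.sub_apply, map_sub, pow_succ Q (T + 1)]; rfl
      rw [this]
      simp only [Pi.add_apply, Pi.sub_apply]
      push_cast; ring
  refine ⟨z s, ?_⟩
  have hlim : Tendsto (fun T : ℕ => (1 / (T : ℝ)) * ((Q ^ (T + 1)) w s - Q w s)) atTop (𝓝 0) := by
    refine squeeze_zero_norm (a := fun T : ℕ => (2 * C) / (T : ℝ)) (fun T => ?_)
      (tendsto_const_div_atTop_nhds_zero_nat _)
    have h1 := hpow (T + 1) w C hC s
    have h2 := hQ w C hC s
    have h3 := abs_sub ((Q ^ (T + 1)) w s) (Q w s)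
    rw [Real.norm_eq_abs, abs_mul, abs_of_nonneg (by positivity), one_div, div_eq_inv_mul]
    exact mul_le_mul_of_nonneg_left (by linarith) (by positivity)
  have h3 := (tendsto_const_nhds (x := z s)).add hlim
  rw [add_zero] at h3
  refine h3.congr' ?_
  filter_upwards [eventually_gt_atTop 0] with T hT
  have : (T : ℝ) ≠ 0 := by positivity
  rw [hsum]; field_simp

/-- If `r t + w (t + 1) ≤ w t + C` for bounded `w`, then the Cesàro limit of `r` is at
most `C`. -/
theorem cesaro_limit_le_of_drift {r w : ℕ → ℝ} {C b l : ℝ} (hw : ∀ t, |w t| ≤ b)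
    (h : ∀ t, r t + w (t + 1) ≤ w t + C)
    (hl : Tendsto (fun T : ℕ => (1 / (T : ℝ)) * ∑ t ∈ Finset.Icc 1 T, r t) atTop (𝓝 l)) :
    l ≤ C := by
  have hsum : ∀ T : ℕ, ∑ t ∈ Finset.Icc 1 T, r t ≤ w 1 - w (T + 1) + T * C := by
    intro T
    induction T with
    | zero => simp
    | succ T ih =>
      rw [Finset.sum_Icc_succ_top (by omega)]
      have := h (T + 1)
      push_cast; linarith
  have h2 : Tendsto (fun T : ℕ => (2 * b) / (T : ℝ) + C) atTop (𝓝 (0 + C)) :=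
    (tendsto_const_div_atTop_nhds_zero_nat _).add tendsto_const_nhds
  rw [zero_add] at h2
  refine le_of_tendsto_of_tendsto hl h2 ?_
  filter_upwards [eventually_gt_atTop 0] with T hT
  have hT' : (0 : ℝ) < T := by positivity
  have h3 := hsum T
  have h4 := abs_le.1 (hw 1)
  have h5 := abs_le.1 (hw (T + 1))
  rw [one_div, inv_mul_le_iff₀ hT', mul_add, mul_div_cancel₀ _ hT'.ne']
  linarith

/-- The marginal of a product of finite distributions. -/
theorem sum_prod_mul_eval {ι : Type*} [Fintype ι] [DecidableEq ι] {κ : ι → Type*}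
    [∀ i, Fintype (κ i)] (f : ∀ i, κ i → ℝ) (hf : ∀ i, ∑ k, f i k = 1) (j : ι) (g : κ j → ℝ) :
    ∑ x : ∀ i, κ i, (∏ i, f i (x i)) * g (x j) = ∑ k, f j k * g k := by
  -- `g` is spread over all coordinates as the factor `1` off `j`, so that the sum of products
  -- factors.
  have h := Fintype.prod_sum (fun i (k : κ i) =>
    f i k * if h : i = j then g (h ▸ k) else 1)
  have h1 : ∀ x : ∀ i, κ i, ∏ i, (f i (x i) * if h : i = j then g (h ▸ x i) else 1)
      = (∏ i, f i (x i)) * g (x j) := by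
    intro x
    rw [Finset.prod_mul_distrib]
    congr 1
    rw [Finset.prod_eq_single j (fun i _ hi => by simp [hi]) (by simp)]
    simp
  rw [Finset.sum_congr rfl fun x _ => h1 x] at h
  rw [← h, Finset.prod_eq_single j (fun i _ hi => by simp [hi, hf]) (by simp)]
  simp

/-- Reindexing behind the aging of packets: class `l + 1` moves to `l`, class `0` carries no value,
and the newcomers `c` fill the top class. For `m = 0` there is no top class, hence `hc`. -/
theorem sum_fin_shift (m : ℕ) (G : Fin m → ℝ) (c : ℝ) (hG : ∀ h : 0 < m, G ⟨0, h⟩ = 0)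
    (hc : m = 0 → c = 0) :
    ∑ l : Fin m, (if h : (l : ℕ) + 1 < m then G ⟨l + 1, h⟩ else c) = (∑ l, G l) + c := by
  cases m with
  | zero => simp [hc rfl]
  | succ m =>
    rw [Fin.sum_univ_castSucc, Fin.sum_univ_succ G]
    have : G 0 = 0 := hG (by omega)
    simp [this, Fin.succ]

variable {N K A : ℕ}

/-! ### The noise of one slot -/

namespace Model

theorem ζ_nonneg (M : Model N K A) (n : Fin N) (i : Fin K) {e : ℝ} (he : e ∈ M.levels) :
    0 ≤ M.ζ n i e := by
  rw [← M.ζ_zero n i]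
  exact (M.ζ_strictMonoOn n i).monotoneOn M.zero_mem_levels he (M.levels_nonneg e he)

theorem ζ_pos (M : Model N K A) (n : Fin N) (i : Fin K) {e : ℝ} (he : e ∈ M.levels)
    (h0 : 0 < e) : 0 < M.ζ n i e := by
  rw [← M.ζ_zero n i]
  exact M.ζ_strictMonoOn n i M.zero_mem_levels he h0

/-- A bounded monotone function on a subset of `ℝ` extends to a monotone function on `ℝ`, which is
Borel. -/
theorem measurable_ζ (M : Model N K A) (n : Fin N) (i : Fin K) :
    Measurable fun e : M.levels => M.ζ n i e := by
  obtain ⟨g, hg, hge⟩ := (M.ζ_strictMonoOn n i).monotoneOn.exists_monotone_extension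
    ⟨0, by rintro _ ⟨e, he, rfl⟩; exact M.ζ_nonneg n i he⟩
    ⟨1, by rintro _ ⟨e, he, rfl⟩; exact M.ζ_le_one n i e he⟩
  have : (fun e : M.levels => M.ζ n i e) = fun e : M.levels => g e :=
    funext fun e => hge e.2
  rw [this]
  exact hg.measurable.comp measurable_subtype_coe

theorem rate_nonneg (M : Model N K A) (n : Fin N) : 0 ≤ M.rate n :=
  Finset.sum_nonneg fun _ _ => mul_nonneg (Nat.cast_nonneg _) ((M.arr_mem n).1 _)

theorem integrable_ζ (M : Model N K A) (n : Fin N) (i : Fin K) (m : Measure M.levels)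
    [IsFiniteMeasure m] : Integrable (fun e : M.levels => M.ζ n i e) m :=
  Integrable.of_bound (M.measurable_ζ n i).aestronglyMeasurable 1
    (ae_of_all _ fun e => by
      rw [Real.norm_eq_abs, abs_of_nonneg (M.ζ_nonneg n i e.2)]; exact M.ζ_le_one n i e e.2)

theorem integrable_level (M : Model N K A) (m : Measure M.levels)
    [IsFiniteMeasure m] : Integrable (fun e : M.levels => (e : ℝ)) m := by
  obtain ⟨C, hC⟩ := M.levels_bddAbove
  exact Integrable.of_bound measurable_subtype_coe.aestronglyMeasurable C
    (ae_of_all _ fun e => by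
      rw [Real.norm_eq_abs, abs_of_nonneg (M.levels_nonneg e e.2)]; exact hC e.2)

end Model

variable (M : Model N K A) (L : Fin N → ℕ)

theorem noiseProb_nonneg (s : State K A L) (a : Action M L) (w : Noise K A L) :
    0 ≤ noiseProb M L s a w := by
  refine mul_nonneg (mul_nonneg (Finset.prod_nonneg fun p _ => ?_)
    (Finset.prod_nonneg fun n _ => (M.arr_mem n).1 _)) (Finset.prod_nonneg fun n _ => ?_)
  · split_ifs
    · exact M.ζ_nonneg _ _ (a p).2
    · exact sub_nonneg.2 (M.ζ_le_one _ _ _ (a p).2)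
  · exact (M.P_stochastic n).1 _ _

/-- By independence the three kinds of noise factor. The next channel states sum out, because
rewards and potentials do not depend on them. -/
theorem sum_noiseProb_factor (s : State K A L) (a : Action M L)
    (f : (Place A L → Bool) → ℝ) (g : (Fin N → Fin (A + 1)) → ℝ) :
    ∑ w, noiseProb M L s a w * (f w.1 * g w.2.1) =
      (∑ x : Place A L → Bool, (∏ p : Place A L, if x p then M.ζ p.1 (s.1 p.1) (a p : ℝ)
          else 1 - M.ζ p.1 (s.1 p.1) (a p : ℝ)) * f x) *
        ∑ y : Fin N → Fin (A + 1), (∏ n, M.arr n (y n)) * g y := by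
  have hP : ∑ z : Fin N → Fin K, ∏ n, M.P n (s.1 n) (z n) = 1 := by
    rw [← Fintype.prod_sum fun n k => M.P n (s.1 n) k]
    exact Finset.prod_eq_one fun n _ => Matrix.sum_row_of_mem_rowStochastic (M.P_stochastic n) _
  simp only [Fintype.sum_prod_type]
  calc _ = ∑ x : Place A L → Bool, ∑ y : Fin N → Fin (A + 1), ∑ z : Fin N → Fin K,
        (((∏ p : Place A L, if x p then M.ζ p.1 (s.1 p.1) (a p : ℝ)
          else 1 - M.ζ p.1 (s.1 p.1) (a p : ℝ)) * f x) * ((∏ n, M.arr n (y n)) * g y)) *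
          ∏ n, M.P n (s.1 n) (z n) := by
        refine Finset.sum_congr rfl fun x _ => Finset.sum_congr rfl fun y _ =>
          Finset.sum_congr rfl fun z _ => ?_
        simp only [noiseProb]; ring
    _ = _ := by simp only [← Finset.mul_sum, hP, mul_one, ← Finset.sum_mul]

theorem sum_noiseProb_transmission (s : State K A L) (a : Action M L) (p : Place A L)
    (g : Bool → ℝ) :
    ∑ w, noiseProb M L s a w * g (w.1 p) =
      M.ζ p.1 (s.1 p.1) (a p) * g true + (1 - M.ζ p.1 (s.1 p.1) (a p)) * g false := by
  have h := sum_noiseProb_factor M L s a (fun x => g (x p)) (fun _ => 1)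
  simp only [mul_one] at h
  rw [h, ← Fintype.prod_sum fun n k => M.arr n k,
    Finset.prod_eq_one fun n _ => (M.arr_mem n).2, mul_one,
    sum_prod_mul_eval (fun (p : Place A L) (b : Bool) => if b then M.ζ p.1 (s.1 p.1) (a p : ℝ)
          else 1 - M.ζ p.1 (s.1 p.1) (a p : ℝ)) (by simp) p g]
  simp

theorem sum_noiseProb_arrival (s : State K A L) (a : Action M L) (n : Fin N)
    (g : Fin (A + 1) → ℝ) :
    ∑ w, noiseProb M L s a w * g (w.2.1 n) = ∑ m, M.arr n m * g m := by
  have h := sum_noiseProb_factor M L s a (fun _ => 1) (fun y => g (y n))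
  simp only [one_mul, mul_one] at h
  rw [h, ← Fintype.prod_sum fun (p : Place A L) (b : Bool) =>
      if b then M.ζ p.1 (s.1 p.1) (a p : ℝ) else 1 - M.ζ p.1 (s.1 p.1) (a p : ℝ),
    Finset.prod_eq_one fun n _ => by simp, one_mul,
    sum_prod_mul_eval (fun n k => M.arr n k) (fun n => (M.arr_mem n).2) n g]

theorem sum_noiseProb (s : State K A L) (a : Action M L) : ∑ w, noiseProb M L s a w = 1 := by
  have h := sum_noiseProb_factor M L s a (fun _ => 1) (fun _ => 1)
  simp only [mul_one] at h
  rw [h, ← Fintype.prod_sum fun (p : Place A L) (b : Bool) =>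
      if b then M.ζ p.1 (s.1 p.1) (a p : ℝ) else 1 - M.ζ p.1 (s.1 p.1) (a p : ℝ),
    Finset.prod_eq_one fun n _ => by simp, one_mul, ← Fintype.prod_sum fun n k => M.arr n k,
    Finset.prod_eq_one fun n _ => (M.arr_mem n).2]

/-! ### Potentials -/

/-- The total value of the packets at the source when a packet of user `n` with time-to-deadline
`t` has value `u n t`. -/
noncomputable def potential (u : Fin N → ℕ → ℝ) (s : State K A L) : ℝ :=
  ∑ p : Place A L, if s.2 p then u p.1 (p.2.1 + 1) else 0

/-- An undelivered packet at index `ℓ` has time-to-deadline `ℓ + 1`, so it is worth `u n ℓ` after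
the slot; expired packets are worth `0` by `hu`. -/
theorem potential_next {u : Fin N → ℕ → ℝ} (hu : ∀ n, u n 0 = 0) (s : State K A L)
    (w : Noise K A L) :
    potential L u (next L s w) =
      (∑ p : Place A L, if s.2 p && !w.1 p then u p.1 p.2.1 else 0) +
        ∑ n, ((w.2.1 n : ℕ) : ℝ) * u n (L n) := by
  simp only [potential, Fintype.sum_sigma, Fintype.sum_prod_type]
  rw [← Finset.sum_add_distrib]
  refine Finset.sum_congr rfl fun n _ => ?_
  have hcount : ∑ k : Fin A, (if decide ((k : ℕ) < (w.2.1 n : ℕ)) then u n (L n) else 0)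
      = ((w.2.1 n : ℕ) : ℝ) * u n (L n) := by
    rw [← Finset.sum_filter, Finset.sum_const, nsmul_eq_mul]
    congr 2
    have h1 := (w.2.1 n).2
    simp only [decide_eq_true_eq]
    rw [Fin.card_filter_val_lt]
    omega
  rw [← hcount, ← sum_fin_shift (L n) (fun l => ∑ k : Fin A,
    if s.2 ⟨n, l, k⟩ && !w.1 ⟨n, l, k⟩ then u n l else 0) _ (by intro h; simp [hu])
    (by intro h; simp [h, hu])]
  refine Finset.sum_congr rfl fun l _ => ?_
  split_ifs with h
  · refine Finset.sum_congr rfl fun k _ => ?_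
    simp only [next, dif_pos h]
  · refine Finset.sum_congr rfl fun k _ => ?_
    have hl : (l : ℕ) + 1 = L n := by have := l.2; omega
    simp [next, hl]

theorem sum_mul_delivered (b : Fin N → ℝ) (s : State K A L) (w : Noise K A L) :
    ∑ n, b n * delivered L n s w =
      ∑ p : Place A L, if s.2 p then (if w.1 p then b p.1 else 0) else 0 := by
  simp only [delivered, Finset.mul_sum]
  rw [Finset.sum_comm]
  refine Finset.sum_congr rfl fun p _ => ?_
  rw [Finset.sum_eq_single p.1 (fun n _ hn => by simp [hn.symm]) (by simp)]
  by_cases h1 : s.2 p = true <;> by_cases h2 : w.1 p = true <;> simp [h1, h2]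

theorem sum_resource (s : State K A L) (a : Action M L) :
    ∑ n, resource M L n s a = ∑ p : Place A L, if s.2 p then (a p : ℝ) else 0 := by
  simp only [resource]
  rw [Finset.sum_comm]
  refine Finset.sum_congr rfl fun p _ => ?_
  rw [Finset.sum_eq_single p.1 (fun n _ hn => by simp [hn.symm]) (by simp)]
  simp

/-- The expected reward plus potential after one slot. -/
theorem sum_noiseProb_reward_add_potential {u : Fin N → ℕ → ℝ} (hu : ∀ n, u n 0 = 0)
    (b : Fin N → ℝ) (s : State K A L) (a : Action M L) :
    ∑ w, noiseProb M L s a w * (∑ n, b n * delivered L n s w + potential L u (next L s w)) =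
      (∑ p : Place A L, if s.2 p then M.ζ p.1 (s.1 p.1) (a p) * b p.1 +
        (1 - M.ζ p.1 (s.1 p.1) (a p)) * u p.1 p.2.1 else 0) + ∑ n, M.rate n * u n (L n) := by
  have h1 : ∀ w : Noise K A L,
      noiseProb M L s a w * (∑ n, b n * delivered L n s w + potential L u (next L s w)) =
      (∑ p : Place A L, if s.2 p then
        noiseProb M L s a w * (if w.1 p then b p.1 else u p.1 p.2.1) else 0) +
        ∑ n, noiseProb M L s a w * (((w.2.1 n : ℕ) : ℝ) * u n (L n)) := by
    intro w
    rw [sum_mul_delivered, potential_next L hu, ← add_assoc, ← Finset.sum_add_distrib, mul_add,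
      Finset.mul_sum, Finset.mul_sum]
    congr 1
    refine Finset.sum_congr rfl fun p _ => ?_
    cases s.2 p <;> cases w.1 p <;> simp
  rw [Finset.sum_congr rfl fun w _ => h1 w, Finset.sum_add_distrib, Finset.sum_comm]
  congr 1
  · refine Finset.sum_congr rfl fun p _ => ?_
    split_ifs with h
    · have := sum_noiseProb_transmission M L s a p fun c => if c then b p.1 else u p.1 p.2.1
      simpa using this
    · simp
  · rw [Finset.sum_comm]
    refine Finset.sum_congr rfl fun n _ => ?_
    rw [sum_noiseProb_arrival M L s a n fun m => ((m : ℕ) : ℝ) * u n (L n), Model.rate,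
      Finset.sum_mul]
    exact Finset.sum_congr rfl fun m _ => by ring

/-! ### Expectations -/

theorem measurable_noiseProb (s : State K A L) (w : Noise K A L) :
    Measurable fun a : Action M L => noiseProb M L s a w := by
  have h : ∀ p : Place A L, Measurable fun a : Action M L => M.ζ p.1 (s.1 p.1) (a p : ℝ) :=
    fun p => (M.measurable_ζ p.1 (s.1 p.1)).comp (measurable_pi_apply p)
  unfold noiseProb
  refine Measurable.mul_const (Measurable.mul_const (Finset.measurable_fun_prod _ fun p _ => ?_) _) _
  split_ifs
  · exact h p
  · exact (h p).const_sub 1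

theorem integrable_noiseProb (s : State K A L) (w : Noise K A L) (m : Measure (Action M L))
    [IsFiniteMeasure m] : Integrable (fun a => noiseProb M L s a w) m :=
  Integrable.of_bound (measurable_noiseProb M L s w).aestronglyMeasurable 1
    (ae_of_all _ fun a => by
      rw [Real.norm_eq_abs, abs_of_nonneg (noiseProb_nonneg M L s a w),
        ← sum_noiseProb M L s a]
      exact Finset.single_le_sum (f := fun w => noiseProb M L s a w)
        (fun w _ => noiseProb_nonneg M L s a w) (Finset.mem_univ w))

/-- The probability of an outcome of one slot under a randomized action. -/
noncomputable def outcomeProb (s : State K A L) (m : Measure (Action M L)) (w : Noise K A L) : ℝ :=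
  ∫ a, noiseProb M L s a w ∂m

theorem outcomeProb_nonneg (s : State K A L) (m : Measure (Action M L)) (w : Noise K A L) :
    0 ≤ outcomeProb M L s m w :=
  integral_nonneg fun a => noiseProb_nonneg M L s a w

theorem sum_outcomeProb (s : State K A L) (m : Measure (Action M L)) [IsProbabilityMeasure m] :
    ∑ w, outcomeProb M L s m w = 1 := by
  unfold outcomeProb
  rw [← integral_finsetSum _ fun w _ => integrable_noiseProb M L s w m]
  simp [sum_noiseProb]

theorem slotExp_outcome (π : Policy M L) (s : State K A L) (h : List (State K A L))
    (f : Noise K A L → ℝ) :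
    slotExp M L π s h (fun _ w => f w) = ∑ w, outcomeProb M L s (π s h) w * f w := by
  unfold slotExp outcomeProb
  rw [integral_finsetSum _ fun w _ => (integrable_noiseProb M L s w _).mul_const _]
  exact Finset.sum_congr rfl fun w _ => integral_mul_const _ _

theorem slotExp_action (π : Policy M L) (s : State K A L) (h : List (State K A L))
    (f : Action M L → ℝ) :
    slotExp M L π s h (fun a _ => f a) = ∫ a, f a ∂(π s h : Measure (Action M L)) := by
  unfold slotExp
  simp only [← Finset.sum_mul, sum_noiseProb, one_mul]

/-- The expectation over histories is a finite convex combination. -/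
theorem exists_histExp_eq_sum (π : Policy M L) {μ : State K A L → ℝ}
    (hμ : μ ∈ stdSimplex ℝ (State K A L)) (t : ℕ) :
    ∃ (ι : Type) (_ : Fintype ι) (c : ι → ℝ) (S : ι → State K A L) (H : ι → List (State K A L)),
      (∀ i, 0 ≤ c i) ∧ ∑ i, c i = 1 ∧
        ∀ f, histExp M L π μ t f = ∑ i, c i * f (S i) (H i) := by
  induction t with
  | zero => exact ⟨State K A L, inferInstance, μ, id, fun _ => [], hμ.1, hμ.2, fun f => rfl⟩
  | succ t ih =>
    obtain ⟨ι, _, c, S, H, hc, hc1, hf⟩ := ih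
    -- Each slot appends one noise outcome to the index, so only finitely many histories occur and
    -- no measure on paths is needed.
    refine ⟨ι × Noise K A L, inferInstance,
      fun x => c x.1 * outcomeProb M L (S x.1) (π (S x.1) (H x.1)) x.2,
      fun x => next L (S x.1) x.2, fun x => S x.1 :: H x.1,
      fun x => mul_nonneg (hc _) (outcomeProb_nonneg _ _ _ _ _), ?_, fun f => ?_⟩
    · rw [Fintype.sum_prod_type]
      simp only [← Finset.mul_sum, sum_outcomeProb, mul_one, hc1]
    · rw [histExp, hf, Fintype.sum_prod_type]
      refine Finset.sum_congr rfl fun i _ => ?_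
      rw [slotExp_outcome, Finset.mul_sum]
      exact Finset.sum_congr rfl fun w _ => by ring

section

variable {π : Policy M L} {μ : State K A L → ℝ} (hμ : μ ∈ stdSimplex ℝ (State K A L)) (t : ℕ)
include hμ

theorem histExp_add (f g : State K A L → List (State K A L) → ℝ) :
    histExp M L π μ t (fun s h => f s h + g s h) =
      histExp M L π μ t f + histExp M L π μ t g := by
  obtain ⟨ι, _, c, S, H, -, -, hf⟩ := exists_histExp_eq_sum M L π hμ t
  simp only [hf, mul_add, Finset.sum_add_distrib]

theorem histExp_const_mul (r : ℝ) (f : State K A L → List (State K A L) → ℝ) :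
    histExp M L π μ t (fun s h => r * f s h) = r * histExp M L π μ t f := by
  obtain ⟨ι, _, c, S, H, -, -, hf⟩ := exists_histExp_eq_sum M L π hμ t
  simp only [hf, Finset.mul_sum]
  exact Finset.sum_congr rfl fun i _ => by ring

theorem histExp_sum {κ : Type*} (I : Finset κ)
    (f : κ → State K A L → List (State K A L) → ℝ) :
    histExp M L π μ t (fun s h => ∑ k ∈ I, f k s h) = ∑ k ∈ I, histExp M L π μ t (f k) := by
  obtain ⟨ι, _, c, S, H, -, -, hf⟩ := exists_histExp_eq_sum M L π hμ t
  simp only [hf, Finset.mul_sum]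
  exact Finset.sum_comm

theorem histExp_mono {f g : State K A L → List (State K A L) → ℝ} (hfg : ∀ s h, f s h ≤ g s h) :
    histExp M L π μ t f ≤ histExp M L π μ t g := by
  obtain ⟨ι, _, c, S, H, hc, -, hf⟩ := exists_histExp_eq_sum M L π hμ t
  simp only [hf]
  exact Finset.sum_le_sum fun i _ => mul_le_mul_of_nonneg_left (hfg _ _) (hc i)

theorem histExp_const (r : ℝ) : histExp M L π μ t (fun _ _ => r) = r := by
  obtain ⟨ι, _, c, S, H, -, hc1, hf⟩ := exists_histExp_eq_sum M L π hμ t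
  simp only [hf, ← Finset.sum_mul, hc1, one_mul]

theorem abs_histExp_le {f : State K A L → List (State K A L) → ℝ} {C : ℝ}
    (hfC : ∀ s h, |f s h| ≤ C) : |histExp M L π μ t f| ≤ C := by
  rw [abs_le]
  constructor
  · rw [← histExp_const M L (π := π) hμ t (-C)]
    exact histExp_mono M L hμ t fun s h => (abs_le.1 (hfC s h)).1
  · rw [← histExp_const M L (π := π) hμ t C]
    exact histExp_mono M L hμ t fun s h => (abs_le.1 (hfC s h)).2

end

theorem integrable_level_eval (m : Measure (Action M L)) [IsFiniteMeasure m] (p : Place A L) :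
    Integrable (fun a : Action M L => (a p : ℝ)) m := by
  obtain ⟨C, hC⟩ := M.levels_bddAbove
  exact Integrable.of_bound (measurable_subtype_coe.comp (measurable_pi_apply p)).aestronglyMeasurable
    C (ae_of_all _ fun a => by
      rw [Real.norm_eq_abs, abs_of_nonneg (M.levels_nonneg _ (a p).2)]; exact hC (a p).2)

theorem integrable_ζ_eval (m : Measure (Action M L)) [IsFiniteMeasure m] (p : Place A L)
    (i : Fin K) : Integrable (fun a : Action M L => M.ζ p.1 i (a p)) m :=
  Integrable.of_bound
    ((M.measurable_ζ p.1 i).comp (measurable_pi_apply p)).aestronglyMeasurable 1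
    (ae_of_all _ fun a => by
      rw [Real.norm_eq_abs, abs_of_nonneg (M.ζ_nonneg _ _ (a p).2)]
      exact M.ζ_le_one _ _ _ (a p).2)

theorem integrable_resource (m : Measure (Action M L)) [IsFiniteMeasure m] (n : Fin N)
    (s : State K A L) : Integrable (fun a => resource M L n s a) m := by
  unfold resource
  refine integrable_finsetSum _ fun p _ => ?_
  split_ifs
  · exact integrable_level_eval M L m p
  · exact integrable_zero _ _ _

/-! ### The drift inequality -/

/-- Drift inequality: if at each place the expected one-slot reward plus future value is at most
the present value `u`, then the long-run net reward is at most the value of the arriving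
packets. -/
theorem reward_le_of_drift {u : Fin N → ℕ → ℝ} (hu : ∀ n, u n 0 = 0) (b : Fin N → ℝ) (lam : ℝ)
    {π : Policy M L} {μ : State K A L → ℝ} (hμ : μ ∈ stdSimplex ℝ (State K A L))
    (H : ∀ (s : State K A L) (h : List (State K A L)) (p : Place A L),
      ∫ a, (M.ζ p.1 (s.1 p.1) (a p) * b p.1 + (1 - M.ζ p.1 (s.1 p.1) (a p)) * u p.1 p.2.1
        - lam * (a p : ℝ)) ∂(π s h : Measure (Action M L)) ≤ u p.1 (p.2.1 + 1))
    {x : Fin N → ℝ} {e : ℝ} (hx : HasThroughput M L π μ x) (he : HasExpenditure M L π μ e) :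
    ∑ n, b n * x n - lam * e ≤ ∑ n, M.rate n * u n (L n) := by
  have hlim : Tendsto (fun T : ℕ => (1 / (T : ℝ)) * ∑ t ∈ Finset.Icc 1 T,
      (∑ n, b n * expDelivered M L π μ n t - lam * ∑ n, expResource M L π μ n t)) atTop
      (𝓝 (∑ n, b n * x n - lam * e)) := by
    refine ((tendsto_finsetSum _ fun n _ => (hx n).const_mul (b n)).sub
      (he.const_mul lam)).congr fun T => ?_
    rw [Finset.sum_sub_distrib, ← Finset.mul_sum _ _ lam, mul_sub]
    congr 1
    · simp only [Finset.mul_sum]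
      rw [Finset.sum_comm]
      exact Finset.sum_congr rfl fun n _ => Finset.sum_congr rfl fun t _ => by ring
    · ring
  refine cesaro_limit_le_of_drift (w := fun t => histExp M L π μ t fun s _ => potential L u s)
    (b := ∑ s : State K A L, |potential L u s|)
    (fun t => abs_histExp_le M L hμ t fun s _ => Finset.single_le_sum
      (f := fun s => |potential L u s|) (fun _ _ => abs_nonneg _) (Finset.mem_univ s))
    (fun t => ?_) hlim
  have hslot : ∀ s h, ∑ n, b n * slotExp M L π s h (fun _ w => delivered L n s w) +
      (-lam) * ∑ n, slotExp M L π s h (fun a _ => resource M L n s a) +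
      slotExp M L π s h (fun _ w => potential L u (next L s w)) ≤
      potential L u s + ∑ n, M.rate n * u n (L n) := by
    intro s h
    have h1 : ∑ n, b n * slotExp M L π s h (fun _ w => delivered L n s w) +
        slotExp M L π s h (fun _ w => potential L u (next L s w)) =
        ∫ a, ((∑ p : Place A L, if s.2 p then M.ζ p.1 (s.1 p.1) (a p) * b p.1 +
          (1 - M.ζ p.1 (s.1 p.1) (a p)) * u p.1 p.2.1 else 0) +
            ∑ n, M.rate n * u n (L n)) ∂(π s h : Measure (Action M L)) := by
      simp only [slotExp_outcome, Finset.mul_sum]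
      rw [Finset.sum_comm, ← Finset.sum_add_distrib]
      simp only [← sum_noiseProb_reward_add_potential M L hu]
      rw [integral_finsetSum _ fun w _ => (integrable_noiseProb M L s w _).mul_const _]
      refine Finset.sum_congr rfl fun w _ => ?_
      rw [integral_mul_const, outcomeProb, mul_add, Finset.mul_sum]
      congr 1
      exact Finset.sum_congr rfl fun n _ => by ring
    have hint : ∀ p : Place A L, Integrable (fun a : Action M L =>
        M.ζ p.1 (s.1 p.1) (a p) * b p.1 + (1 - M.ζ p.1 (s.1 p.1) (a p)) * u p.1 p.2.1)
        (π s h : Measure (Action M L)) := fun p =>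
      ((integrable_ζ_eval M L _ p _).mul_const _).add
        (((integrable_const _).sub (integrable_ζ_eval M L _ p _)).mul_const _)
    have hint' : ∀ p : Place A L, Integrable (fun a : Action M L => if s.2 p then
        M.ζ p.1 (s.1 p.1) (a p) * b p.1 + (1 - M.ζ p.1 (s.1 p.1) (a p)) * u p.1 p.2.1 else 0)
        (π s h : Measure (Action M L)) := fun p => by
      split_ifs
      · exact hint p
      · exact integrable_zero _ _ _
    have h2 : ∑ n, slotExp M L π s h (fun a _ => resource M L n s a) =
        ∑ p : Place A L, ∫ a, (if s.2 p then (a p : ℝ) else 0)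
          ∂(π s h : Measure (Action M L)) := by
      simp only [slotExp_action]
      rw [← integral_finsetSum _ fun n _ => integrable_resource M L _ n s]
      simp only [sum_resource]
      refine integral_finsetSum _ fun p _ => ?_
      split_ifs
      · exact integrable_level_eval M L _ p
      · exact integrable_zero _ _ _
    rw [add_right_comm, h1, h2, integral_add (integrable_finsetSum _ fun p _ => hint' p)
      (integrable_const _), integral_finsetSum _ fun p _ => hint' p, integral_const]
    simp only [probReal_univ, one_smul]
    rw [add_right_comm]
    -- The arrival terms agree on both sides; what remains splits into one inequality per occupied
    -- place.
    refine add_le_add_left ?_ _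
    rw [Finset.mul_sum, ← Finset.sum_add_distrib, potential]
    refine Finset.sum_le_sum fun p _ => ?_
    split_ifs with hp
    · rw [← integral_const_mul, ← integral_add (hint p)
        ((integrable_level_eval M L _ p).const_mul _)]
      refine le_trans (le_of_eq ?_) (H s h p)
      exact integral_congr_ae (ae_of_all _ fun a => by simp only; ring)
    · simp
  have h3 := histExp_mono M L (π := π) hμ t hslot
  rw [histExp_add M L hμ, histExp_add M L hμ, histExp_add M L hμ, histExp_const M L hμ,
    histExp_const_mul M L hμ, histExp_sum M L hμ, histExp_sum M L hμ] at h3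
  simp only [histExp_const_mul M L hμ] at h3
  rw [show histExp M L π μ (t + 1) (fun s _ => potential L u s) = histExp M L π μ t fun s h =>
    slotExp M L π s h fun _ w => potential L u (next L s w) from rfl]
  unfold expDelivered expResource
  linarith

/-! ### The upper bound -/

instance (M : Model N K A) : Nonempty {e : ℝ // e ∈ M.levels ∧ 0 < e} :=
  let ⟨e, he, h0⟩ := M.exists_pos_level
  ⟨⟨e, he, h0⟩⟩

instance (M : Model N K A) : Nonempty M.levels := ⟨⟨0, M.zero_mem_levels⟩⟩

section

variable {iMin iMax : Fin N → Fin K} {lam : ℝ} (hlam : 0 ≤ lam) (n : Fin N) (t : ℕ)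
include hlam

/-- Supplies the upper bound without which the real `⨆` in `lowerValue` could take its default value
`0`. -/
theorem lowerTerm_le (i : Fin K) {e : ℝ} (he : e ∈ M.levels) (h0 : 0 < e) :
    (1 - (1 - M.ζ n i e) ^ t) / M.ζ n i e * (-lam * e + M.ζ n i e * M.β n) ≤ M.β n := by
  have hz := M.ζ_pos n i he h0
  have hz1 := M.ζ_le_one n i e he
  have hp0 : 0 ≤ (1 - M.ζ n i e) ^ t := pow_nonneg (by linarith) t
  have hp1 : (1 - M.ζ n i e) ^ t ≤ 1 := pow_le_one₀ (by linarith) (by linarith)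
  have hβ := M.β_nonneg n
  calc _ ≤ (1 - (1 - M.ζ n i e) ^ t) / M.ζ n i e * (M.ζ n i e * M.β n) :=
        mul_le_mul_of_nonneg_left (by nlinarith) (div_nonneg (by linarith) hz.le)
    _ = (1 - (1 - M.ζ n i e) ^ t) * M.β n := by field_simp
    _ ≤ M.β n := by nlinarith

theorem lowerValue_le_weight : lowerValue M iMin lam n t ≤ M.β n :=
  ciSup_le fun e => lowerTerm_le M hlam n t (iMin n) e.2.1 e.2.2

theorem lowerTerm_le_lowerValue {e : ℝ} (he : e ∈ M.levels) (h0 : 0 < e) :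
    (1 - (1 - M.ζ n (iMin n) e) ^ t) / M.ζ n (iMin n) e * (-lam * e + M.ζ n (iMin n) e * M.β n)
      ≤ lowerValue M iMin lam n t := by
  refine le_ciSup (f := fun e : {e : ℝ // e ∈ M.levels ∧ 0 < e} =>
    (1 - (1 - M.ζ n (iMin n) e) ^ t) / M.ζ n (iMin n) e *
      (-lam * e + M.ζ n (iMin n) e * M.β n)) ⟨M.β n, ?_⟩ ⟨e, he, h0⟩
  rintro _ ⟨e, rfl⟩
  exact lowerTerm_le M hlam n t (iMin n) e.2.1 e.2.2

theorem le_upperValue_succ {e : ℝ} (he : e ∈ M.levels) :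
    upperValue M iMin iMax lam n t + (-lam * e + M.ζ n (iMax n) e *
      (M.β n - max 0 (lowerValue M iMin lam n t))) ≤ upperValue M iMin iMax lam n (t + 1) := by
  rw [upperValue, upperValue, Finset.sum_Icc_succ_top (by omega), Nat.add_sub_cancel]
  refine add_le_add_right (le_ciSup (f := fun e : M.levels => -lam * (e : ℝ) + M.ζ n (iMax n) e *
      (M.β n - max 0 (lowerValue M iMin lam n t))) ⟨M.β n, ?_⟩ ⟨e, he⟩) _
  rintro _ ⟨e, rfl⟩
  have h1 : max 0 (lowerValue M iMin lam n t) ≤ M.β n :=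
    max_le (M.β_nonneg n) (lowerValue_le_weight M hlam n t)
  have h2 : 0 ≤ max 0 (lowerValue M iMin lam n t) := le_max_left _ _
  have h3 := mul_nonneg hlam (M.levels_nonneg e e.2)
  have h4 := M.ζ_le_one n (iMax n) e e.2
  have h5 := M.ζ_nonneg n (iMax n) e.2
  simp only
  nlinarith

theorem upperValue_le_succ :
    upperValue M iMin iMax lam n t ≤ upperValue M iMin iMax lam n (t + 1) := by
  have := le_upperValue_succ M hlam n t (iMin := iMin) (iMax := iMax) M.zero_mem_levels
  simpa [M.ζ_zero] using this

/-- This is what allows `upperValue` to use `lowerValue` as continuation value. For a fixed level of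
success probability `z` in the worst state, the value obeys `W (t + 1) = (1 - z) * W t + (z * β -
lam * e)`. Bounding `W t` by `upperValue` and passing from the worst to the best state gives at most
one increment of `upperValue`. -/
theorem lowerValue_le_upperValue
    (hMin : ∀ n i, ∀ e ∈ M.levels, M.ζ n (iMin n) e ≤ M.ζ n i e) :
    max 0 (lowerValue M iMin lam n t) ≤ upperValue M iMin iMax lam n t := by
  induction t with
  | zero => simp [lowerValue_zero, upperValue]
  | succ t ih =>
    refine max_le (((le_max_left _ _).trans ih).trans (upperValue_le_succ M hlam n t)) ?_
    refine ciSup_le fun e => ?_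
    obtain ⟨e, he, h0⟩ := e
    refine le_trans ?_ (le_upperValue_succ M hlam n t he)
    have hz := M.ζ_pos n (iMin n) he h0
    have hz1 := M.ζ_le_one n (iMin n) e he
    have h1 : max 0 (lowerValue M iMin lam n t) ≤ M.β n :=
      max_le (M.β_nonneg n) (lowerValue_le_weight M hlam n t)
    have h2 := (lowerTerm_le_lowerValue M hlam n t (iMin := iMin) he h0).trans
      ((le_max_right 0 _).trans ih)
    have h3 := hMin n (iMax n) e he
    have h4 : (1 - (1 - M.ζ n (iMin n) e) ^ (t + 1)) / M.ζ n (iMin n) e *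
        (-lam * e + M.ζ n (iMin n) e * M.β n) = (1 - M.ζ n (iMin n) e) *
        ((1 - (1 - M.ζ n (iMin n) e) ^ t) / M.ζ n (iMin n) e *
        (-lam * e + M.ζ n (iMin n) e * M.β n)) + (-lam * e + M.ζ n (iMin n) e * M.β n) := by
      field_simp; ring
    have h5 := mul_le_mul_of_nonneg_left h2 (sub_nonneg.2 hz1)
    have h6 := mul_le_mul_of_nonneg_left (sub_le_sub_left ih (M.β n)) hz.le
    have h7 := mul_le_mul_of_nonneg_right h3 (sub_nonneg.2 h1)
    rw [h4]
    linarith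

/-- The Bellman inequality for `min (β n) (upperValue n)`. -/
theorem upperValue_bellman (hMin : ∀ n i, ∀ e ∈ M.levels, M.ζ n (iMin n) e ≤ M.ζ n i e)
    (hMax : ∀ n i, ∀ e ∈ M.levels, M.ζ n i e ≤ M.ζ n (iMax n) e) (i : Fin K) {e : ℝ}
    (he : e ∈ M.levels) :
    M.ζ n i e * M.β n + (1 - M.ζ n i e) * min (M.β n) (upperValue M iMin iMax lam n t) - lam * e
      ≤ min (M.β n) (upperValue M iMin iMax lam n (t + 1)) := by
  have hz := M.ζ_nonneg n i he
  have hz1 := M.ζ_le_one n i e he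
  have h0 := mul_nonneg hlam (M.levels_nonneg e he)
  have h1 := mul_le_mul_of_nonneg_left (min_le_left (M.β n) (upperValue M iMin iMax lam n t))
    (sub_nonneg.2 hz1)
  have h2 := mul_le_mul_of_nonneg_left (min_le_right (M.β n) (upperValue M iMin iMax lam n t))
    (sub_nonneg.2 hz1)
  -- Against `β n` nothing is left to show, as no outcome is worth more. Against `V = upperValue`,
  -- the left side is at most `V + ζ * (β - V) - lam * e`. Here `V` dominates `max 0 lowerValue` and
  -- `ζ` is at most its best-state value, which leaves one increment of `upperValue`.
  refine le_min (by linarith) (le_trans ?_ (le_upperValue_succ M hlam n t he))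
  have h3 : max 0 (lowerValue M iMin lam n t) ≤ M.β n :=
    max_le (M.β_nonneg n) (lowerValue_le_weight M hlam n t)
  have h6 := mul_le_mul_of_nonneg_left (sub_le_sub_left
    (lowerValue_le_upperValue M hlam n t (iMax := iMax) hMin) (M.β n)) hz
  have h7 := mul_le_mul_of_nonneg_right (hMax n i e he) (sub_nonneg.2 h3)
  linarith

end

theorem integral_le_of_place_le {s : State K A L} {p : Place A L} {m : Measure (Action M L)}
    [IsProbabilityMeasure m] {b c lam C : ℝ}
    (h : ∀ e ∈ M.levels, M.ζ p.1 (s.1 p.1) e * b + (1 - M.ζ p.1 (s.1 p.1) e) * c - lam * e ≤ C) :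
    ∫ a, (M.ζ p.1 (s.1 p.1) (a p) * b + (1 - M.ζ p.1 (s.1 p.1) (a p)) * c
        - lam * (a p : ℝ)) ∂m ≤ C := by
  have hi := integrable_ζ_eval M L m p (s.1 p.1)
  refine (integral_mono (((hi.mul_const b).add (((integrable_const 1).sub hi).mul_const c)).sub
    ((integrable_level_eval M L m p).const_mul lam)) (integrable_const C)
    fun a => h _ (a p).2).trans ?_
  simp

/-- Required by `Real.sSup_le`, which also covers the empty set with `sSup ∅ = 0`. -/
theorem dualUpper_nonneg {iMin iMax : Fin N → Fin K} {B lam : ℝ} (hB : 0 ≤ B) (hlam : 0 ≤ lam)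
    (hMin : ∀ n i, ∀ e ∈ M.levels, M.ζ n (iMin n) e ≤ M.ζ n i e) :
    0 ≤ dualUpper M L iMin iMax B lam :=
  add_nonneg (mul_nonneg hlam hB) (Finset.sum_nonneg fun n _ => mul_nonneg (M.rate_nonneg n)
    (le_min (M.β_nonneg n)
      ((le_max_left _ _).trans (lowerValue_le_upperValue M hlam n (L n) hMin))))

theorem weighted_throughput_le_dualUpper {iMin iMax : Fin N → Fin K} {B lam : ℝ}
    (hlam : 0 ≤ lam)
    (hMin : ∀ n i, ∀ e ∈ M.levels, M.ζ n (iMin n) e ≤ M.ζ n i e)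
    (hMax : ∀ n i, ∀ e ∈ M.levels, M.ζ n i e ≤ M.ζ n (iMax n) e)
    {π : Policy M L} {μ : State K A L → ℝ} (hμ : μ ∈ stdSimplex ℝ (State K A L))
    {x : Fin N → ℝ} {e : ℝ} (hx : HasThroughput M L π μ x) (he : HasExpenditure M L π μ e)
    (heB : e ≤ B) :
    ∑ n, M.β n * x n ≤ dualUpper M L iMin iMax B lam := by
  have h := reward_le_of_drift M L
    (u := fun n t => min (M.β n) (upperValue M iMin iMax lam n t))
    (fun n => by simp [upperValue, M.β_nonneg n]) M.β lam hμ
    (fun s h p => integral_le_of_place_le M L fun e he =>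
      upperValue_bellman M hlam p.1 p.2.1 hMin hMax _ he) hx he
  have h2 := mul_le_mul_of_nonneg_left heB hlam
  rw [dualUpper]
  linarith

theorem optThroughput_le_dualUpper {iMin iMax : Fin N → Fin K} {B lam : ℝ} (hB : 0 ≤ B)
    (hlam : 0 ≤ lam)
    (hMin : ∀ n i, ∀ e ∈ M.levels, M.ζ n (iMin n) e ≤ M.ζ n i e)
    (hMax : ∀ n i, ∀ e ∈ M.levels, M.ζ n i e ≤ M.ζ n (iMax n) e)
    {μ : State K A L → ℝ} (hμ : μ ∈ stdSimplex ℝ (State K A L)) :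
    optThroughput M L μ B ≤ dualUpper M L iMin iMax B lam := by
  refine Real.sSup_le ?_ (dualUpper_nonneg M L hB hlam hMin)
  rintro _ ⟨π, x, e, hx, he, heB, rfl⟩
  exact weighted_throughput_le_dualUpper M L hlam hMin hMax hμ hx he heB

/-! ### Stationary policies -/

/-- The transition operator of the system under a stationary randomized policy. -/
noncomputable def transitionOp (ν : State K A L → ProbabilityMeasure (Action M L)) :
    (State K A L → ℝ) →ₗ[ℝ] (State K A L → ℝ) where
  toFun f s := ∑ w, outcomeProb M L s (ν s) w * f (next L s w)
  map_add' f g := by ext s; simp [mul_add, Finset.sum_add_distrib]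
  map_smul' r f := by
    ext s
    simp only [Pi.smul_apply, smul_eq_mul, RingHom.id_apply, Finset.mul_sum]
    exact Finset.sum_congr rfl fun w _ => by ring

theorem abs_transitionOp_le (ν : State K A L → ProbabilityMeasure (Action M L))
    (f : State K A L → ℝ) (C : ℝ) (hf : ∀ s, |f s| ≤ C) (s : State K A L) :
    |transitionOp M L ν f s| ≤ C := by
  calc |∑ w, outcomeProb M L s (ν s) w * f (next L s w)|
      ≤ ∑ w, |outcomeProb M L s (ν s) w * f (next L s w)| := Finset.abs_sum_le_sum_abs _ _
    _ ≤ ∑ w, outcomeProb M L s (ν s) w * C := by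
        refine Finset.sum_le_sum fun w _ => ?_
        rw [abs_mul, abs_of_nonneg (outcomeProb_nonneg M L s _ w)]
        exact mul_le_mul_of_nonneg_left (hf _) (outcomeProb_nonneg M L s _ w)
    _ = C := by rw [← Finset.sum_mul, sum_outcomeProb, one_mul]

theorem histExp_stationary (ν : State K A L → ProbabilityMeasure (Action M L))
    (μ : State K A L → ℝ) (t : ℕ) (g : State K A L → ℝ) :
    histExp M L (fun s _ => ν s) μ t (fun s _ => g s) =
      ∑ s, μ s * (transitionOp M L ν ^ t) g s := by
  induction t generalizing g with
  | zero => simp [histExp]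
  | succ t ih =>
    rw [pow_succ, Module.End.mul_apply, ← ih, histExp]
    simp only [slotExp_outcome]
    rfl

theorem exists_tendsto_histExp (ν : State K A L → ProbabilityMeasure (Action M L))
    (μ : State K A L → ℝ) (g : State K A L → ℝ) :
    ∃ l, Tendsto (fun T : ℕ => (1 / (T : ℝ)) * ∑ t ∈ Finset.Icc 1 T,
      histExp M L (fun s _ => ν s) μ t (fun s _ => g s)) atTop (𝓝 l) := by
  choose l hl using exists_tendsto_cesaro_pow (transitionOp M L ν) (abs_transitionOp_le M L ν) g
  refine ⟨∑ s, μ s * l s, (tendsto_finsetSum _ fun s _ => (hl s).const_mul (μ s)).congr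
    fun T => ?_⟩
  simp only [histExp_stationary, Finset.mul_sum]
  rw [Finset.sum_comm]
  exact Finset.sum_congr rfl fun t _ => Finset.sum_congr rfl fun s _ => by ring

/-- The long-run averages exist under a stationary policy. -/
theorem exists_limits_of_stationary (ν : State K A L → ProbabilityMeasure (Action M L))
    (μ : State K A L → ℝ) :
    ∃ x e, HasThroughput M L (fun s _ => ν s) μ x ∧ HasExpenditure M L (fun s _ => ν s) μ e := by
  have h1 : ∀ n, ∃ l, Tendsto (fun T : ℕ => (1 / (T : ℝ)) * ∑ t ∈ Finset.Icc 1 T,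
      expDelivered M L (fun s _ => ν s) μ n t) atTop (𝓝 l) := fun n => by
    unfold expDelivered
    simp only [slotExp_outcome]
    exact exists_tendsto_histExp M L ν μ _
  have h2 : ∀ n, ∃ l, Tendsto (fun T : ℕ => (1 / (T : ℝ)) * ∑ t ∈ Finset.Icc 1 T,
      expResource M L (fun s _ => ν s) μ n t) atTop (𝓝 l) := fun n => by
    unfold expResource
    simp only [slotExp_action]
    exact exists_tendsto_histExp M L ν μ _
  choose x hx using h1
  choose e he using h2
  refine ⟨x, ∑ n, e n, hx, (tendsto_finsetSum _ fun n _ => he n).congr fun T => ?_⟩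
  rw [Finset.sum_comm, Finset.mul_sum]

/-! ### Achievable cost-reward pairs -/

/-- Pairs (cost bound, success probability) that randomized levels achieve in one slot, for a
packet of user `n` in channel state `i`. -/
def chanRegion (n : Fin N) (i : Fin K) : Set (ℝ × ℝ) :=
  {y | ∃ m : ProbabilityMeasure M.levels, ∫ e, M.ζ n i e ∂(m : Measure M.levels) = y.2 ∧
    ∫ e, (e : ℝ) ∂(m : Measure M.levels) ≤ y.1}

/-- Pairs that are achievable in one slot in every channel state. -/
def slotRegion (n : Fin N) : Set (ℝ × ℝ) := ⋂ i, chanRegion M n i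

/-- Convexity comes from mixing probability measures on the levels, not from the shape of `ζ`. -/
theorem convex_chanRegion (n : Fin N) (i : Fin K) : Convex ℝ (chanRegion M n i) := by
  rintro y ⟨m, hm, hm'⟩ z ⟨k, hk, hk'⟩ a b ha hb hab
  have hprob : IsProbabilityMeasure
      (ENNReal.ofReal a • (m : Measure M.levels) + ENNReal.ofReal b • (k : Measure M.levels)) :=
    ⟨by simp [← ENNReal.ofReal_add ha hb, hab]⟩
  have hint : ∀ f : M.levels → ℝ, (∀ μ : ProbabilityMeasure M.levels,
      Integrable f (μ : Measure M.levels)) →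
      ∫ e, f e ∂(ENNReal.ofReal a • (m : Measure M.levels) +
        ENNReal.ofReal b • (k : Measure M.levels)) =
      a * ∫ e, f e ∂(m : Measure M.levels) + b * ∫ e, f e ∂(k : Measure M.levels) := by
    intro f hf
    rw [integral_add_measure ((hf m).smul_measure ENNReal.ofReal_ne_top)
      ((hf k).smul_measure ENNReal.ofReal_ne_top), integral_smul_measure, integral_smul_measure,
      ENNReal.toReal_ofReal ha, ENNReal.toReal_ofReal hb, smul_eq_mul, smul_eq_mul]
  refine ⟨⟨_, hprob⟩, ?_, ?_⟩
  · rw [ProbabilityMeasure.coe_mk, hint _ fun μ => M.integrable_ζ n i _, hm, hk]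
    simp
  · rw [ProbabilityMeasure.coe_mk, hint _ fun μ => M.integrable_level _]
    simp only [Prod.fst_add, Prod.smul_fst, smul_eq_mul]
    exact add_le_add (mul_le_mul_of_nonneg_left hm' ha) (mul_le_mul_of_nonneg_left hk' hb)

theorem level_mem_chanRegion (n : Fin N) (i : Fin K) {e : ℝ} (he : e ∈ M.levels) :
    (e, M.ζ n i e) ∈ chanRegion M n i :=
  ⟨⟨Measure.dirac ⟨e, he⟩, inferInstance⟩,
    by simp [integral_dirac' _ _ (M.measurable_ζ n i).stronglyMeasurable],
    by simp [integral_dirac' _ _ (measurable_subtype_coe (p := (· ∈ M.levels))).stronglyMeasurable]⟩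

theorem zero_mem_chanRegion (n : Fin N) (i : Fin K) : (0 : ℝ × ℝ) ∈ chanRegion M n i := by
  have := level_mem_chanRegion M n i M.zero_mem_levels
  rwa [M.ζ_zero] at this

theorem convex_slotRegion (n : Fin N) : Convex ℝ (slotRegion M n) :=
  convex_iInter fun i => convex_chanRegion M n i

theorem zero_mem_slotRegion (n : Fin N) : (0 : ℝ × ℝ) ∈ slotRegion M n :=
  Set.mem_iInter.2 fun i => zero_mem_chanRegion M n i

/-- In state `i`, use `e` with probability `ζ n (iMin n) e / ζ n i e` and level `0` otherwise. The
success probability is exactly that of the worst state, and the mean cost is at most `e`. -/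
theorem level_mem_slotRegion {iMin : Fin N → Fin K}
    (hMin : ∀ n i, ∀ e ∈ M.levels, M.ζ n (iMin n) e ≤ M.ζ n i e) (n : Fin N) {e : ℝ}
    (he : e ∈ M.levels) (h0 : 0 < e) : (e, M.ζ n (iMin n) e) ∈ slotRegion M n := by
  refine Set.mem_iInter.2 fun i => ?_
  have hz := M.ζ_pos n i he h0
  have hz' := M.ζ_nonneg n (iMin n) he
  have hθ : M.ζ n (iMin n) e / M.ζ n i e ≤ 1 := (div_le_one hz).2 (hMin n i e he)
  obtain ⟨m, hm, hm'⟩ := (convex_chanRegion M n i).smul_mem_of_zero_mem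
    (zero_mem_chanRegion M n i) (level_mem_chanRegion M n i he) ⟨div_nonneg hz' hz.le, hθ⟩
  refine ⟨m, hm.trans ?_, hm'.trans ?_⟩
  · simp only [Prod.smul_snd, smul_eq_mul]
    field_simp
  · simp only [Prod.smul_fst, smul_eq_mul]
    exact mul_le_of_le_one_left h0.le hθ

/-- A state `i` is needed: over an empty `Fin K` the intersection `slotRegion` would be everything.
-/
theorem le_one_of_mem_slotRegion {n : Fin N} (i : Fin K) {y : ℝ × ℝ} (hy : y ∈ slotRegion M n) :
    y.2 ≤ 1 := by
  obtain ⟨m, hm, -⟩ := Set.mem_iInter.1 hy i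
  rw [← hm]
  refine (integral_mono (M.integrable_ζ n i _) (integrable_const 1)
    fun e => M.ζ_le_one n i e e.2).trans ?_
  simp

/-! ### Plans over the lifetime of a packet -/

/-- Pairs (expected cost, delivery probability) that are achievable for a packet with `t` remaining
slots when each slot allows the pairs in `Z`. -/
def planRegion (Z : Set (ℝ × ℝ)) : ℕ → Set (ℝ × ℝ)
  | 0 => {0}
  | t + 1 => {y | ∃ x ∈ Z, ∃ r ∈ planRegion Z t,
      y = (x.1 + (1 - x.2) * r.1, x.2 + (1 - x.2) * r.2)}

theorem zero_mem_planRegion {Z : Set (ℝ × ℝ)} (hZ : 0 ∈ Z) (t : ℕ) : 0 ∈ planRegion Z t := by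
  induction t with
  | zero => rfl
  | succ t ih => exact ⟨0, hZ, 0, ih, Prod.ext (by simp) (by simp)⟩

/-- Continuations only matter for packets that survive the first slot, so they are mixed with
weights proportional to `a * (1 - x.2)` and `b * (1 - x'.2)`. If both vanish, any continuation will
do. -/
theorem convex_planRegion {Z : Set (ℝ × ℝ)} (hZ : Convex ℝ Z) (hZ1 : ∀ x ∈ Z, x.2 ≤ 1) (t : ℕ) :
    Convex ℝ (planRegion Z t) := by
  induction t with
  | zero => exact convex_singleton 0
  | succ t ih =>
    rintro _ ⟨x, hx, r, hr, rfl⟩ _ ⟨x', hx', r', hr', rfl⟩ a b ha hb hab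
    have h1 := mul_nonneg ha (sub_nonneg.2 (hZ1 x hx))
    have h2 := mul_nonneg hb (sub_nonneg.2 (hZ1 x' hx'))
    obtain ⟨q, hq, hq1, hq2⟩ : ∃ q ∈ planRegion Z t,
        (a * (1 - x.2) + b * (1 - x'.2)) * q.1 = a * (1 - x.2) * r.1 + b * (1 - x'.2) * r'.1 ∧
        (a * (1 - x.2) + b * (1 - x'.2)) * q.2 = a * (1 - x.2) * r.2 + b * (1 - x'.2) * r'.2 := by
      rcases (add_nonneg h1 h2).eq_or_lt with h | h
      · refine ⟨r, hr, ?_, ?_⟩ <;>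
        · rw [← h, show a * (1 - x.2) = 0 by linarith, show b * (1 - x'.2) = 0 by linarith]
          ring
      · refine ⟨_, ih hr hr' (div_nonneg h1 h.le) (div_nonneg h2 h.le)
          (by rw [← add_div, div_self h.ne']), ?_, ?_⟩ <;>
        · simp only [Prod.fst_add, Prod.snd_add, Prod.smul_fst, Prod.smul_snd, smul_eq_mul]
          generalize a * (1 - x.2) + b * (1 - x'.2) = S at h
          field_simp
    refine ⟨a • x + b • x', hZ hx hx' ha hb hab, q, hq, ?_⟩
    have hS : 1 - (a * x.2 + b * x'.2) = a * (1 - x.2) + b * (1 - x'.2) := by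
      linear_combination -hab
    ext
    · simp only [Prod.fst_add, Prod.snd_add, Prod.smul_fst, Prod.smul_snd, smul_eq_mul, hS, hq1]
      ring
    · simp only [Prod.snd_add, Prod.smul_snd, smul_eq_mul, hS, hq2]
      ring

/-- Unfolds a plan into a table indexed by time-to-deadline, which serves both as potential and as
recipe for a stationary policy. -/
theorem exists_plan {Z : Set (ℝ × ℝ)} {t : ℕ} {y : ℝ × ℝ} (hy : y ∈ planRegion Z t) :
    ∃ r : ℕ → ℝ × ℝ, r 0 = 0 ∧ r t = y ∧ ∀ l < t, ∃ x ∈ Z,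
      r (l + 1) = (x.1 + (1 - x.2) * (r l).1, x.2 + (1 - x.2) * (r l).2) := by
  induction t generalizing y with
  | zero => exact ⟨fun _ => 0, rfl, (Set.mem_singleton_iff.1 hy).symm, by simp⟩
  | succ t ih =>
    obtain ⟨x, hx, q, hq, rfl⟩ := hy
    obtain ⟨r, h0, ht, hr⟩ := ih hq
    refine ⟨fun l => if l ≤ t then r l else (x.1 + (1 - x.2) * q.1, x.2 + (1 - x.2) * q.2),
      by simp [h0], by simp, fun l hl => ?_⟩
    rcases Nat.lt_succ_iff_lt_or_eq.1 hl with h | rfl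
    · obtain ⟨z, hz, hrz⟩ := hr l h
      exact ⟨z, hz, by simpa [h.le, Nat.succ_le_iff.2 h] using hrz⟩
    · exact ⟨x, hx, by simp [ht]⟩

/-- Repeating one pair until success takes `(1 - (1 - z) ^ t) / z` transmissions on average. -/
theorem level_mem_planRegion {Z : Set (ℝ × ℝ)} {e z : ℝ} (hz : 0 < z) (he : (e, z) ∈ Z) (t : ℕ) :
    (e * ((1 - (1 - z) ^ t) / z), 1 - (1 - z) ^ t) ∈ planRegion Z t := by
  induction t with
  | zero => simp [planRegion]
  | succ t ih =>
    refine ⟨_, he, _, ih, ?_⟩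
    ext
    · simp only; field_simp; ring
    · simp only; ring

/-- Every plan is realized by a stationary policy. -/
theorem exists_policy_of_plan {y : Fin N → ℝ × ℝ}
    (hy : ∀ n, y n ∈ planRegion (slotRegion M n) (L n)) {μ : State K A L → ℝ}
    (hμ : μ ∈ stdSimplex ℝ (State K A L)) :
    ∃ (π : Policy M L) (x : Fin N → ℝ) (e : ℝ), HasThroughput M L π μ x ∧
      HasExpenditure M L π μ e ∧ e ≤ ∑ n, M.rate n * (y n).1 ∧
      ∑ n, M.rate n * (M.β n * (y n).2) ≤ ∑ n, M.β n * x n := by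
  choose r hr0 hrL hr using fun n => exists_plan (hy n)
  choose x hx hrx using hr
  choose m hm hm' using fun n l hl i => Set.mem_iInter.1 (hx n l hl) i
  -- Levels are drawn independently over places. Index `p.2.1` stands for time-to-deadline `p.2.1 +
  -- 1`, so the pair used is the one leading from `r p.2.1` to `r (p.2.1 + 1)`.
  let ν : State K A L → ProbabilityMeasure (Action M L) := fun s =>
    ⟨Measure.pi fun p : Place A L =>
      (m p.1 p.2.1 p.2.1.2 (s.1 p.1) : Measure M.levels), inferInstance⟩
  have hint : ∀ (s : State K A L) (p : Place A L) (b c lam : ℝ),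
      ∫ a, (M.ζ p.1 (s.1 p.1) (a p) * b + (1 - M.ζ p.1 (s.1 p.1) (a p)) * c - lam * (a p : ℝ))
        ∂(ν s : Measure (Action M L)) = (x p.1 p.2.1 p.2.1.2).2 * b +
          (1 - (x p.1 p.2.1 p.2.1.2).2) * c - lam * ∫ e, (e : ℝ)
            ∂(m p.1 p.2.1 p.2.1.2 (s.1 p.1) : Measure M.levels) := by
    intro s p b c lam
    have hi := M.integrable_ζ p.1 (s.1 p.1)
      (m p.1 p.2.1 p.2.1.2 (s.1 p.1) : Measure M.levels)
    have hl := M.integrable_level (m p.1 p.2.1 p.2.1.2 (s.1 p.1) : Measure M.levels)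
    have h0 : Integrable (fun e : M.levels => (1 - M.ζ p.1 (s.1 p.1) e) * c)
        (m p.1 p.2.1 p.2.1.2 (s.1 p.1) : Measure M.levels) :=
      ((integrable_const 1).sub hi).mul_const c
    have h1 : Integrable (fun e : M.levels => M.ζ p.1 (s.1 p.1) e * b +
        (1 - M.ζ p.1 (s.1 p.1) e) * c) (m p.1 p.2.1 p.2.1.2 (s.1 p.1) : Measure M.levels) :=
      (hi.mul_const b).add h0
    have h2 := integral_comp_eval
      (μ := fun p : Place A L => (m p.1 p.2.1 p.2.1.2 (s.1 p.1) : Measure M.levels)) (i := p)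
      (f := fun e : M.levels => M.ζ p.1 (s.1 p.1) e * b + (1 - M.ζ p.1 (s.1 p.1) e) * c
        - lam * (e : ℝ)) (h1.sub (hl.const_mul lam)).aestronglyMeasurable
    refine h2.trans ?_
    rw [integral_sub h1 (hl.const_mul lam), integral_const_mul,
      integral_add (hi.mul_const b) h0,
      integral_mul_const, integral_mul_const, integral_sub (integrable_const 1) hi, hm]
    simp
  obtain ⟨v, e, hv, he⟩ := exists_limits_of_stationary M L ν μ
  refine ⟨_, v, e, hv, he, ?_, ?_⟩
  -- With zero reward and price `-1`, the drift inequality bounds the expenditure above by the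
  -- planned cost.
  · have h := reward_le_of_drift M L (u := fun n t => (r n t).1) (fun n => by simp [hr0])
      0 (-1) hμ (fun s _ p => ?_) hv he
    · simpa [hrL] using h
    · rw [hint, hrx p.1 p.2.1 p.2.1.2]
      have := hm' p.1 p.2.1 p.2.1.2 (s.1 p.1)
      simp only [Pi.zero_apply]
      linarith
  -- With all rewards negated and price `0`, it bounds the throughput below.
  · have h := reward_le_of_drift M L (u := fun n t => -(M.β n * (r n t).2))
      (fun n => by simp [hr0]) (fun n => -M.β n) 0 hμ (fun s _ p => ?_) hv he
    · simpa [hrL] using h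
    · rw [hint, hrx p.1 p.2.1 p.2.1.2]
      simp only
      linarith

/-! ### The lower bound -/

theorem optThroughput_bddAbove {iMin iMax : Fin N → Fin K} {B : ℝ}
    (hMin : ∀ n i, ∀ e ∈ M.levels, M.ζ n (iMin n) e ≤ M.ζ n i e)
    (hMax : ∀ n i, ∀ e ∈ M.levels, M.ζ n i e ≤ M.ζ n (iMax n) e)
    {μ : State K A L → ℝ} (hμ : μ ∈ stdSimplex ℝ (State K A L)) :
    BddAbove {v : ℝ | ∃ (π : Policy M L) (x : Fin N → ℝ) (e : ℝ), HasThroughput M L π μ x ∧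
      HasExpenditure M L π μ e ∧ e ≤ B ∧ v = ∑ n, M.β n * x n} := by
  refine ⟨dualUpper M L iMin iMax B 0, ?_⟩
  rintro _ ⟨π, x, e, hx, he, heB, rfl⟩
  exact weighted_throughput_le_dualUpper M L le_rfl hMin hMax hμ hx he heB

theorem plan_le_optThroughput {iMin iMax : Fin N → Fin K} {B : ℝ}
    (hMin : ∀ n i, ∀ e ∈ M.levels, M.ζ n (iMin n) e ≤ M.ζ n i e)
    (hMax : ∀ n i, ∀ e ∈ M.levels, M.ζ n i e ≤ M.ζ n (iMax n) e)
    {μ : State K A L → ℝ} (hμ : μ ∈ stdSimplex ℝ (State K A L))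
    {y : Fin N → ℝ × ℝ} (hy : ∀ n, y n ∈ planRegion (slotRegion M n) (L n))
    (hyB : ∑ n, M.rate n * (y n).1 ≤ B) :
    ∑ n, M.rate n * (M.β n * (y n).2) ≤ optThroughput M L μ B := by
  obtain ⟨π, x, e, hx, he, heB, h⟩ := exists_policy_of_plan M L hy hμ
  exact h.trans (le_csSup (optThroughput_bddAbove M L hMin hMax hμ)
    ⟨π, x, e, hx, he, heB.trans hyB, rfl⟩)

/-- Without budget, the lower dual function tends to zero. -/
theorem exists_dualLower_zero_budget_le {iMin : Fin N → Fin K}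
    (hcont : ∀ n i, ContinuousWithinAt (M.ζ n i) M.levels 0) {ε : ℝ} (hε : 0 < ε) :
    ∃ lam, 0 ≤ lam ∧ dualLower M L iMin 0 lam ≤ ε := by
  have hR : 0 ≤ ∑ n, M.rate n := Finset.sum_nonneg fun n _ => M.rate_nonneg n
  have hδ : 0 < ε / (1 + ∑ n, M.rate n) := by positivity
  have key : ∀ n, ∃ l : ℝ, 0 ≤ l ∧ ∀ lam, l ≤ lam →
      max 0 (lowerValue M iMin lam n (L n)) ≤ ε / (1 + ∑ n, M.rate n) := by
    intro n
    have hβ := M.β_nonneg n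
    have hη : 0 < ε / (1 + ∑ n, M.rate n) / (L n * M.β n + 1) := by positivity
    obtain ⟨d, hd, hd'⟩ := Metric.continuousWithinAt_iff.1 (hcont n (iMin n)) _ hη
    -- Below `d` the success probability is small and Bernoulli's inequality bounds the gain by `L n
    -- * ζ * β`; from `d` on, the price `lam * e ≥ β n` leaves no gain.
    refine ⟨M.β n / d, by positivity, fun lam hlam => max_le hδ.le (ciSup_le fun e => ?_)⟩
    obtain ⟨e, he, h0⟩ := e
    simp only
    have hz := M.ζ_pos n (iMin n) he h0
    have hz1 := M.ζ_le_one n (iMin n) e he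
    have hlam0 : 0 ≤ lam := le_trans (by positivity) hlam
    have hp1 : (1 - M.ζ n (iMin n) e) ^ L n ≤ 1 := pow_le_one₀ (by linarith) (by linarith)
    have hq : 0 ≤ (1 - (1 - M.ζ n (iMin n) e) ^ L n) / M.ζ n (iMin n) e :=
      div_nonneg (by linarith) hz.le
    rcases lt_or_ge e d with hed | hed
    · have h1 : M.ζ n (iMin n) e < ε / (1 + ∑ n, M.rate n) / (L n * M.β n + 1) := by
        have := hd' he (by simpa [Real.dist_eq, abs_of_pos h0] using hed)
        rwa [M.ζ_zero, Real.dist_eq, sub_zero, abs_of_pos hz] at this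
      have h2 : 1 - (1 - M.ζ n (iMin n) e) ^ L n ≤ L n * M.ζ n (iMin n) e := by
        have := one_add_mul_le_pow (a := -M.ζ n (iMin n) e) (by linarith) (L n)
        rw [← sub_eq_add_neg] at this
        linarith
      calc _ ≤ (1 - (1 - M.ζ n (iMin n) e) ^ L n) / M.ζ n (iMin n) e *
            (M.ζ n (iMin n) e * M.β n) :=
            mul_le_mul_of_nonneg_left (by nlinarith) hq
        _ = (1 - (1 - M.ζ n (iMin n) e) ^ L n) * M.β n := by field_simp
        _ ≤ L n * M.ζ n (iMin n) e * M.β n := mul_le_mul_of_nonneg_right h2 hβ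
        _ = M.ζ n (iMin n) e * (L n * M.β n) := by ring
        _ ≤ M.ζ n (iMin n) e * (L n * M.β n + 1) := by nlinarith
        _ ≤ ε / (1 + ∑ n, M.rate n) := by
            rw [← le_div_iff₀ (by positivity)]; exact h1.le
    · have h1 : M.β n ≤ lam * e := by
        calc M.β n ≤ lam * d := (div_le_iff₀ hd).1 hlam
          _ ≤ lam * e := mul_le_mul_of_nonneg_left hed hlam0
      exact (mul_nonpos_of_nonneg_of_nonpos hq (by nlinarith)).trans hδ.le
  choose l hl0 hl using key
  refine ⟨∑ n, l n, Finset.sum_nonneg fun n _ => hl0 n, ?_⟩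
  have h1 : ∀ n, max 0 (lowerValue M iMin (∑ n, l n) n (L n)) ≤ ε / (1 + ∑ n, M.rate n) :=
    fun n => hl n _ (Finset.single_le_sum (fun n _ => hl0 n) (Finset.mem_univ n))
  calc dualLower M L iMin 0 (∑ n, l n)
      ≤ ∑ n, M.rate n * (ε / (1 + ∑ n, M.rate n)) := by
        rw [dualLower, mul_zero, zero_add]
        exact Finset.sum_le_sum fun n _ => mul_le_mul_of_nonneg_left (h1 n) (M.rate_nonneg n)
    _ ≤ ε := by
        rw [← Finset.sum_mul, mul_div_assoc', div_le_iff₀ (by positivity)]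
        nlinarith

/-- If every plan has Lagrangian at most `c`, then so does the lower dual function. -/
theorem dualLower_le_of_plans {iMin : Fin N → Fin K} {B lam c : ℝ}
    (hMin : ∀ n i, ∀ e ∈ M.levels, M.ζ n (iMin n) e ≤ M.ζ n i e)
    (h : ∀ y : Fin N → ℝ × ℝ, (∀ n, y n ∈ planRegion (slotRegion M n) (L n)) →
      ∑ n, M.rate n * (M.β n * (y n).2) - lam * ∑ n, M.rate n * (y n).1 + lam * B ≤ c) :
    dualLower M L iMin B lam ≤ c := by
  refine le_of_forall_pos_le_add fun ε hε => ?_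
  have hR : 0 ≤ ∑ n, M.rate n := Finset.sum_nonneg fun n _ => M.rate_nonneg n
  have hδ : 0 < ε / (1 + ∑ n, M.rate n) := by positivity
  have key : ∀ n, ∃ y ∈ planRegion (slotRegion M n) (L n),
      max 0 (lowerValue M iMin lam n (L n)) - ε / (1 + ∑ n, M.rate n) ≤
        M.β n * y.2 - lam * y.1 := by
    intro n
    -- Idle if the value is nonpositive. Otherwise take a nearly optimal constant level, as the
    -- supremum need not be attained; the rate-weighted errors add up to at most `ε`.
    rcases le_total (lowerValue M iMin lam n (L n)) 0 with h0 | h0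
    · refine ⟨0, zero_mem_planRegion (zero_mem_slotRegion M n) _, ?_⟩
      rw [max_eq_left h0]
      simpa using hδ.le
    · obtain ⟨e, he⟩ := exists_lt_of_lt_ciSup (sub_lt_self (lowerValue M iMin lam n (L n)) hδ)
      obtain ⟨e, hel, he0⟩ := e
      have hz := M.ζ_pos n (iMin n) hel he0
      refine ⟨_, level_mem_planRegion hz (level_mem_slotRegion M hMin n hel he0) _, ?_⟩
      rw [max_eq_right h0]
      refine he.le.trans (le_of_eq ?_)
      simp only
      field_simp
      ring
  choose y hy hyl using key
  have h1 := h y hy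
  have h2 : ∑ n, M.rate n * (max 0 (lowerValue M iMin lam n (L n)) - ε / (1 + ∑ n, M.rate n)) ≤
      ∑ n, M.rate n * (M.β n * (y n).2 - lam * (y n).1) :=
    Finset.sum_le_sum fun n _ => mul_le_mul_of_nonneg_left (hyl n) (M.rate_nonneg n)
  have h3 : (∑ n, M.rate n) * (ε / (1 + ∑ n, M.rate n)) ≤ ε := by
    rw [mul_div_assoc', div_le_iff₀ (by positivity)]
    nlinarith
  have h4 : ∑ n, M.rate n * (M.β n * (y n).2 - lam * (y n).1) =
      ∑ n, M.rate n * (M.β n * (y n).2) - lam * ∑ n, M.rate n * (y n).1 := by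
    rw [Finset.mul_sum, ← Finset.sum_sub_distrib]
    exact Finset.sum_congr rfl fun n _ => by ring
  simp only [mul_sub, Finset.sum_sub_distrib, ← Finset.sum_mul] at h2
  rw [dualLower]
  simp only [mul_sub, Finset.sum_sub_distrib] at h4
  linarith

/-! ### Separation in the cost-reward plane -/

/-- Pairs (cost, reward) that are strictly dominated by a plan. -/
def dominatedRegion : Set (ℝ × ℝ) :=
  {z | ∃ y : Fin N → ℝ × ℝ, (∀ n, y n ∈ planRegion (slotRegion M n) (L n)) ∧
    ∑ n, M.rate n * (y n).1 < z.1 ∧ z.2 < ∑ n, M.rate n * (M.β n * (y n).2)}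

/-- Strict domination gives a union of open quadrants, so separation needs no closedness or
compactness of the set of plans. -/
theorem isOpen_dominatedRegion : IsOpen (dominatedRegion M L) := by
  have : dominatedRegion M L = ⋃ y : {y : Fin N → ℝ × ℝ //
      ∀ n, y n ∈ planRegion (slotRegion M n) (L n)},
      Set.Ioi (∑ n, M.rate n * (y.1 n).1) ×ˢ Set.Iio (∑ n, M.rate n * (M.β n * (y.1 n).2)) := by
    ext z
    simp only [dominatedRegion, Set.mem_ofPred_eq, Set.mem_iUnion, Set.mem_prod, Set.mem_Ioi,
      Set.mem_Iio, Subtype.exists, exists_prop]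
  rw [this]
  exact isOpen_iUnion fun y => isOpen_Ioi.prod isOpen_Iio

theorem convex_dominatedRegion (i : Fin N → Fin K) : Convex ℝ (dominatedRegion M L) := by
  rintro z ⟨y, hy, h1, h2⟩ z' ⟨y', hy', h1', h2'⟩ a b ha hb hab
  refine ⟨fun n => a • y n + b • y' n, fun n => convex_planRegion (convex_slotRegion M n)
    (fun x hx => le_one_of_mem_slotRegion M (i n) hx) _ (hy n) (hy' n) ha hb hab, ?_, ?_⟩
  · have h : ∑ n, M.rate n * (a • y n + b • y' n).1 =
        a * ∑ n, M.rate n * (y n).1 + b * ∑ n, M.rate n * (y' n).1 := by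
      rw [Finset.mul_sum, Finset.mul_sum, ← Finset.sum_add_distrib]
      refine Finset.sum_congr rfl fun n _ => ?_
      simp only [Prod.fst_add, Prod.smul_fst, smul_eq_mul]; ring
    rw [h]
    have := (convex_Ioi (0 : ℝ)) (sub_pos.2 h1) (sub_pos.2 h1') ha hb hab
    simp only [smul_eq_mul, Set.mem_Ioi] at this
    simp only [Prod.fst_add, Prod.smul_fst, smul_eq_mul]
    linarith
  · have h : ∑ n, M.rate n * (M.β n * (a • y n + b • y' n).2) =
        a * ∑ n, M.rate n * (M.β n * (y n).2) + b * ∑ n, M.rate n * (M.β n * (y' n).2) := by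
      rw [Finset.mul_sum, Finset.mul_sum, ← Finset.sum_add_distrib]
      refine Finset.sum_congr rfl fun n _ => ?_
      simp only [Prod.snd_add, Prod.smul_snd, smul_eq_mul]; ring
    rw [h]
    have := (convex_Ioi (0 : ℝ)) (sub_pos.2 h2) (sub_pos.2 h2') ha hb hab
    simp only [smul_eq_mul, Set.mem_Ioi] at this
    simp only [Prod.snd_add, Prod.smul_snd, smul_eq_mul]
    linarith

/-- Lagrange multipliers: a pair that no plan dominates strictly is bounded below by some value of
the lower dual function. -/
theorem exists_dualLower_le_of_notMem {iMin : Fin N → Fin K} {B c : ℝ} (hB : 0 < B)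
    (hMin : ∀ n i, ∀ e ∈ M.levels, M.ζ n (iMin n) e ≤ M.ζ n i e)
    (h : (B, c) ∉ dominatedRegion M L) : ∃ lam, 0 ≤ lam ∧ dualLower M L iMin B lam ≤ c := by
  obtain ⟨f, hf⟩ := geometric_hahn_banach_open_point (convex_dominatedRegion M L iMin)
    (isOpen_dominatedRegion M L) h
  have hfe : ∀ k v : ℝ, f (k, v) = k * f (1, 0) + v * f (0, 1) := by
    intro k v
    rw [← smul_eq_mul, ← smul_eq_mul, ← map_smul, ← map_smul, ← map_add]
    simp
  set α := f (1, 0)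
  set γ := f (0, 1)
  -- Idling dominates this whole quadrant. Letting `k` grow forces `α ≤ 0`, letting `v` decrease
  -- excludes `γ < 0`, and the point with `k = B / 2 < B` excludes a vertical line `γ = 0`. This
  -- last step is where `0 < B` acts as Slater's condition.
  have h0 : ∀ k v : ℝ, 0 < k → v < 0 → k * α + v * γ < B * α + c * γ := by
    intro k v hk hv
    rw [← hfe, ← hfe]
    exact hf _ ⟨fun _ => 0, fun n => zero_mem_planRegion (zero_mem_slotRegion M n) _,
      by simpa using hk, by simpa using hv⟩
  have hα : α ≤ 0 := by
    by_contra! hα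
    have h1 := h0 (B + (|c * γ| + |γ|) / α) (-1) (by positivity) (by norm_num)
    rw [add_mul, div_mul_cancel₀ _ hα.ne'] at h1
    linarith [le_abs_self (c * γ), le_abs_self γ]
  have hγ : 0 < γ := by
    rcases lt_trichotomy γ 0 with hγ | hγ | hγ
    · have h1 := h0 B (-(|c| + 1)) hB (by have := abs_nonneg c; linarith)
      nlinarith [neg_abs_le c]
    · have h1 := h0 (B / 2) (-1) (by positivity) (by norm_num)
      rw [hγ] at h1
      nlinarith
    · exact hγ
  refine ⟨-α / γ, div_nonneg (neg_nonneg.2 hα) hγ.le, dualLower_le_of_plans M L hMin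
    fun y hy => ?_⟩
  have h1 : (∑ n, M.rate n * (y n).1) * α + (∑ n, M.rate n * (M.β n * (y n).2)) * γ ≤
      B * α + c * γ := by
    refine le_of_forall_pos_le_add fun ε hε => ?_
    -- A plan's own pair is only on the boundary; moving it by `ε / (γ - α)` in both coordinates
    -- enters the region and costs exactly `ε` in `f`.
    have hd : 0 < ε / (γ - α) := div_pos hε (by linarith)
    have h2 := hf (∑ n, M.rate n * (y n).1 + ε / (γ - α),
      ∑ n, M.rate n * (M.β n * (y n).2) - ε / (γ - α))
      ⟨y, hy, by simpa using hd, by simpa using hd⟩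
    rw [hfe, hfe] at h2
    have h3 : ε / (γ - α) * (γ - α) = ε := div_mul_cancel₀ _ (by linarith)
    linarith
  rw [← sub_nonneg] at h1 ⊢
  have h2 := div_nonneg h1 hγ.le
  refine h2.trans (le_of_eq ?_)
  field_simp
  ring

/-- Strong duality: the minimum of the lower dual function bounds the optimal throughput from
below. -/
theorem dualLower_le_optThroughput {iMin iMax : Fin N → Fin K} {B lam : ℝ} (hB : 0 ≤ B)
    (hB0 : B = 0 → ∀ n i, ContinuousWithinAt (M.ζ n i) M.levels 0)
    (hMin : ∀ n i, ∀ e ∈ M.levels, M.ζ n (iMin n) e ≤ M.ζ n i e)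
    (hMax : ∀ n i, ∀ e ∈ M.levels, M.ζ n i e ≤ M.ζ n (iMax n) e)
    (hmin : IsMinOn (dualLower M L iMin B) (Set.Ici 0) lam)
    {μ : State K A L → ℝ} (hμ : μ ∈ stdSimplex ℝ (State K A L)) :
    dualLower M L iMin B lam ≤ optThroughput M L μ B := by
  refine le_of_forall_pos_le_add fun ε hε => ?_
  rcases hB.eq_or_lt with rfl | hB
  · obtain ⟨l, hl, hle⟩ := exists_dualLower_zero_budget_le M L (iMin := iMin) (hB0 rfl) hε
    have h1 := plan_le_optThroughput M L hMin hMax hμ (B := 0) (y := fun _ => 0)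
      (fun n => zero_mem_planRegion (zero_mem_slotRegion M n) _) (by simp)
    have h2 := isMinOn_iff.1 hmin l hl
    simp only [Prod.snd_zero, mul_zero, Finset.sum_const_zero] at h1
    linarith
  -- If the pair were not dominated, some multiplier would bring the dual function `ε` below its
  -- minimum.
  · by_cases h : (B, dualLower M L iMin B lam - ε) ∈ dominatedRegion M L
    · obtain ⟨y, hy, h1, h2⟩ := h
      have h3 := plan_le_optThroughput M L hMin hMax hμ hy h1.le
      simp only at h2
      linarith
    · obtain ⟨l, hl, hle⟩ := exists_dualLower_le_of_notMem M L hB hMin h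
      have h2 := isMinOn_iff.1 hmin l hl
      linarith

end TimelyThroughput

theorem mainTheorem9 {N K A : ℕ} (M : TimelyThroughput.Model N K A)
    -- prediction windows and resource budget
    (D : Fin N → ℕ) (B : ℝ) (hB : 0 ≤ B)
    (hB0 : B = 0 → ∀ n i, ContinuousWithinAt (M.ζ n i) M.levels 0)
    -- arbitrary distributions of the initial state without and with prediction
    (μ₀ : TimelyThroughput.State K A M.τ → ℝ)
    (hμ₀ : μ₀ ∈ stdSimplex ℝ (TimelyThroughput.State K A M.τ))
    (μP : TimelyThroughput.State K A (fun n => M.τ n + D n) → ℝ)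
    (hμP : μP ∈ stdSimplex ℝ (TimelyThroughput.State K A (fun n => M.τ n + D n)))
    -- worst and best channel states
    (iMin iMax : Fin N → Fin K)
    (hMin : ∀ n i, ∀ e ∈ M.levels, M.ζ n (iMin n) e ≤ M.ζ n i e)
    (hMax : ∀ n i, ∀ e ∈ M.levels, M.ζ n i e ≤ M.ζ n (iMax n) e)
    -- minimizers over nonnegative multipliers
    (lam₀ lamP : ℝ) (hlam₀ : 0 ≤ lam₀) (hlamP : 0 ≤ lamP)
    (hmin₀ : IsMinOn (TimelyThroughput.dualLower M M.τ iMin B) (Set.Ici 0) lam₀)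
    (hminP : IsMinOn (TimelyThroughput.dualLower M (fun n => M.τ n + D n) iMin B)
      (Set.Ici 0) lamP) :
    TimelyThroughput.dualLower M (fun n => M.τ n + D n) iMin B lamP
        - TimelyThroughput.dualUpper M M.τ iMin iMax B lamP
      ≤ TimelyThroughput.optThroughput M (fun n => M.τ n + D n) μP B
        - TimelyThroughput.optThroughput M M.τ μ₀ B ∧
    TimelyThroughput.optThroughput M (fun n => M.τ n + D n) μP B
        - TimelyThroughput.optThroughput M M.τ μ₀ B
      ≤ TimelyThroughput.dualUpper M (fun n => M.τ n + D n) iMin iMax B lam₀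
        - TimelyThroughput.dualLower M M.τ iMin B lam₀ := by
  have hP := TimelyThroughput.dualLower_le_optThroughput M (fun n => M.τ n + D n) hB hB0 hMin hMax
    hminP hμP
  have h0 := TimelyThroughput.dualLower_le_optThroughput M M.τ hB hB0 hMin hMax hmin₀ hμ₀
  -- Weak duality holds at every multiplier, so each system is bounded above at the minimizer of the
  -- other.
  have hP' := TimelyThroughput.optThroughput_le_dualUpper M (fun n => M.τ n + D n) hB hlam₀ hMin
    hMax hμP
  have h0' := TimelyThroughput.optThroughput_le_dualUpper M M.τ hB hlamP hMin hMax hμ₀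
  exact ⟨sub_le_sub hP h0', sub_le_sub hP' h0⟩
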